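/- Let $L_2(\mathbb R_+)$ be the space of complex-valued square-integrable functions on $(0,\infty)$ with norm $\|\cdot\|$, and let $$(\mathcal H_+f)(x)=\sqrt{\tfrac{2}{\pi}}\int_0^\infty[\cos(xt)+\sin(xt)]\,f(t)\,dt,\qquad x>0,$$ be the half-Hartley transform. Let $C^{(2)}_c(\mathbb R_+)$ be the dense subspace of $L_2(\mathbb R_+)$ of twice continuously differentiable functions with compact support in $(0,\infty)$. For $f\in C^{(2)}_c(\mathbb R_+)$ both $f$ and $\mathcal H_+f$ are absolutely integrable on $(0,\infty)$, so the iterated half-Hartley transform $\mathcal H_+^2f=\mathcal H_+(\mathcal H_+f)$ is defined by absolutely convergent integrals. It extends uniquely from $C^{(2)}_c(\mathbb R_+)$ to a bounded operator $\mathcal H_+^2:L_2(\mathbb R_+)\to L_2(\mathbb R_+)$; this operator is the square of a bounded extension of $\mathcal H_+$ to $L_2(\mathbb R_+)$, and it is invertible with bounded inverse. For every $f\in L_2(\mathbb R_+)$ the following reciprocal formulas hold for almost every $x>0$: $$(\mathcal H_+^2f)(x)=2f(x)+\frac{2}{\pi}\int_0^\infty\frac{f(t)}{x+t}\,dt,$$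 $$f(x)=\frac12(\mathcal H_+^2f)(x)-\frac1{\pi^2}\int_0^\infty\frac{\sqrt{xt}\,[\log x-\log t]}{x^2-t^2}\,(\mathcal H_+^2f)(t)\,dt,$$ where both integrals converge absolutely for every $x>0$. Moreover, for every $f\in L_2(\mathbb R_+)$, $$\|f\|\le\|\mathcal H_+^2f\|\le 8\,\|f\|.$$ -/

import Mathlib

open MeasureTheory Set

/-- Lebesgue measure on the half-line `(0, ∞)`. -/
noncomputable abbrev halfLine : Measure ℝ := volume.restrict (Ioi (0 : ℝ))

/-- The complex Hilbert space `L₂(ℝ₊)`. -/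
abbrev L2HalfLine : Type := Lp ℂ 2 halfLine

/-- The half-Hartley transform
`(H₊ f)(x) = √(2/π) ∫₀^∞ [cos(xt) + sin(xt)] f(t) dt`, as a Lebesgue integral. -/
noncomputable def halfHartley (f : ℝ → ℂ) (x : ℝ) : ℂ :=
  (Real.sqrt (2 / Real.pi) : ℂ) *
    ∫ t in Ioi (0 : ℝ), ((Real.cos (x * t) + Real.sin (x * t) : ℝ) : ℂ) * f t

/-- The class `C_c^(2)(ℝ₊)`: twice continuously differentiable functions with compact support
contained in the open half-line `(0, ∞)`, extended by zero to `ℝ`. -/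
structure IsTestFunction (f : ℝ → ℂ) : Prop where
  contDiff : ContDiff ℝ 2 f
  hasCompactSupport : HasCompactSupport f
  tsupport_subset : tsupport f ⊆ Ioi (0 : ℝ)

/-- The bounded operator `T` on `L₂(ℝ₊)` extends the transform `K`, given on test functions. -/
def ExtendsTransform (K : (ℝ → ℂ) → ℝ → ℂ) (T : L2HalfLine →L[ℂ] L2HalfLine) : Prop :=
  ∀ f : ℝ → ℂ, IsTestFunction f →
    ∃ hf : MemLp f 2 halfLine, (T (hf.toLp f) : ℝ → ℂ) =ᵐ[halfLine] K f

/-- The kernel `√(xt) (log x - log t) / (x² - t²)`; its value on the diagonal `x = t` (a null set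
for each `x`) is irrelevant. -/
noncomputable def logKernel (x t : ℝ) : ℝ :=
  Real.sqrt (x * t) * (Real.log x - Real.log t) / (x ^ 2 - t ^ 2)

/-!
Let `S`, `C` and `M` be the integral operators on `L₂(ℝ₊)` with kernels `1 / (x + t)`,
`√(xt) / (x² + t²)` and `(x + t) / (√2 (x² + t²))`. Their kernels are homogeneous of degree `-1`, so
the Schur test with weight `t ^ (-1 / 2)` shows that they are bounded. Partial fractions give
`S C = π (M - C)` and `M C = (π / 2) S`, and `C²` has the kernel `logKernel`. Hence
`T = 2 + (2 / π) S` and `R = 1 / 2 - C² / π²` satisfy `T R = 1`.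

On test functions `T` is the iterated half-Hartley transform: inserting an Abel factor `exp (-ε y)`
in the outer integral allows Fubini's theorem, and the inner integral becomes a Poisson kernel in
`x - t`, which yields `2 f`, plus a conjugate Poisson kernel in `x + t`, which yields `(2 / π) S f`.
The half-Hartley transform is symmetric, so `⟪H f, H g⟫ = ⟪f, T g⟫` on test functions; therefore `H`
extends to a bounded self-adjoint operator with `H² = T`. In particular `T` is self-adjoint, and its
right inverse `R` is a two-sided inverse.
-/

open Filter Topology
open scoped ENNReal NNReal InnerProductSpace ComplexConjugate

section RationalIntegrals

theorem integral_Ioi_eq_integral_sq (g : ℝ → ℝ) :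
    ∫ y in Ioi (0 : ℝ), g y = ∫ v in Ioi (0 : ℝ), 2 * v * g (v ^ 2) := by
  rw [← integral_comp_rpow_Ioi_of_pos (g := g) (p := 2) (by norm_num)]
  refine setIntegral_congr_fun measurableSet_Ioi fun v _ => ?_
  norm_num

theorem integral_Ioi_eq_integral_inv (g : ℝ → ℝ) :
    ∫ y in Ioi (0 : ℝ), g y = ∫ v in Ioi (0 : ℝ), (v ^ 2)⁻¹ * g v⁻¹ := by
  rw [← integral_comp_rpow_Ioi g (p := -1) (by norm_num)]
  refine setIntegral_congr_fun measurableSet_Ioi fun v (hv : 0 < v) => ?_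
  have h2 : (-1 - 1 : ℝ) = -(2 : ℕ) := by norm_num
  simp only [h2, abs_neg, abs_one, one_mul, Real.rpow_neg hv.le, Real.rpow_natCast, Real.rpow_one,
    smul_eq_mul]

theorem integral_one_div_sq_add_sq {a : ℝ} (ha : 0 < a) :
    ∫ v in Ioi (0 : ℝ), 1 / (a ^ 2 + v ^ 2) = Real.pi / (2 * a) := by
  have hscale : ∀ v : ℝ, 1 / (a ^ 2 + v ^ 2) = (a ^ 2)⁻¹ * (1 + (a⁻¹ * v) ^ 2)⁻¹ := fun v => by
    field_simp
  simp only [hscale]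
  rw [integral_const_mul, integral_comp_mul_left_Ioi (fun v : ℝ => (1 + v ^ 2)⁻¹) 0 (inv_pos.2 ha),
    mul_zero, integral_Ioi_inv_one_add_sq, Real.arctan_zero, smul_eq_mul]
  field_simp
  ring

theorem hasDerivAt_arctan_add_arctan (v : ℝ) :
    HasDerivAt (fun v : ℝ => (√2)⁻¹ * (Real.arctan (√2 * v + 1) + Real.arctan (√2 * v - 1)))
      ((1 + v ^ 2) / (1 + v ^ 4)) v := by
  have h2 : √2 ^ 2 = 2 := Real.sq_sqrt zero_le_two
  have hlin : HasDerivAt (fun v : ℝ => √2 * v) √2 v := by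
    simpa using (hasDerivAt_id v).const_mul √2
  refine (((hlin.add_const 1).arctan.add (hlin.sub_const 1).arctan).const_mul _).congr_deriv ?_
  obtain ⟨p, hp⟩ : ∃ p, p = v ^ 2 + √2 * v + 1 := ⟨_, rfl⟩
  obtain ⟨q, hq⟩ : ∃ q, q = v ^ 2 - √2 * v + 1 := ⟨_, rfl⟩
  have hp_arctan : 1 + (√2 * v + 1) ^ 2 = 2 * p := by linear_combination v ^ 2 * h2 - 2 * hp
  have hq_arctan : 1 + (√2 * v - 1) ^ 2 = 2 * q := by linear_combination v ^ 2 * h2 - 2 * hq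
  have hfactor : 1 + v ^ 4 = p * q := by rw [hp, hq]; linear_combination v ^ 2 * h2
  have hsum : 1 + v ^ 2 = (p + q) / 2 := by rw [hp, hq]; ring
  have hp_ne : p ≠ 0 := by nlinarith [sq_nonneg (√2 * v + 1)]
  have hq_ne : q ≠ 0 := by nlinarith [sq_nonneg (√2 * v - 1)]
  rw [hp_arctan, hq_arctan, hfactor, hsum]
  field_simp
  ring

theorem integral_one_add_sq_div_one_add_pow_four :
    ∫ v in Ioi (0 : ℝ), (1 + v ^ 2) / (1 + v ^ 4) = Real.pi / √2 := by
  have harctan : Tendsto Real.arctan atTop (𝓝 (Real.pi / 2)) :=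
    Real.tendsto_arctan_atTop.mono_right nhdsWithin_le_nhds
  have hlin : Tendsto (fun v : ℝ => √2 * v) atTop atTop :=
    tendsto_id.const_mul_atTop (by positivity)
  rw [integral_Ioi_of_hasDerivAt_of_nonneg' (fun v _ => hasDerivAt_arctan_add_arctan v)
    (fun v _ => by positivity) (((harctan.comp (tendsto_atTop_add_const_right _ 1 hlin)).add
      (harctan.comp (tendsto_atTop_add_const_right _ (-1) hlin))).const_mul _)]
  simp only [mul_zero, zero_add, zero_sub, Real.arctan_neg, add_neg_cancel, sub_zero]
  ring

theorem integral_one_div_one_add_pow_four :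
    ∫ v in Ioi (0 : ℝ), 1 / (1 + v ^ 4) = Real.pi / (2 * √2) := by
  have hinv : ∫ v in Ioi (0 : ℝ), v ^ 2 / (1 + v ^ 4) = ∫ v in Ioi (0 : ℝ), 1 / (1 + v ^ 4) := by
    rw [integral_Ioi_eq_integral_inv]
    refine setIntegral_congr_fun measurableSet_Ioi fun v (hv : 0 < v) => ?_
    field_simp
    ring
  have hsum := integral_one_add_sq_div_one_add_pow_four
  have hint : IntegrableOn (fun v : ℝ => (1 + v ^ 2) / (1 + v ^ 4)) (Ioi 0) :=
    .of_integral_ne_zero (by rw [hsum]; positivity)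
  simp only [add_div] at hsum hint
  rw [integral_add, hinv] at hsum
  · rw [← mul_right_inj' two_ne_zero, two_mul, hsum]
    field_simp
  all_goals
    refine hint.mono' (Measurable.aestronglyMeasurable (by fun_prop)) (ae_of_all _ fun v => ?_)
    rw [Real.norm_of_nonneg (by positivity)]
    simp only [le_add_iff_nonneg_left, le_add_iff_nonneg_right]
    positivity

theorem integral_one_div_pow_four_add_pow_four {b : ℝ} (hb : 0 < b) :
    ∫ v in Ioi (0 : ℝ), 1 / (v ^ 4 + b ^ 4) = Real.pi / (2 * √2 * b ^ 3) := by
  have hscale : ∀ v : ℝ, 1 / (v ^ 4 + b ^ 4) = (b ^ 4)⁻¹ * (1 / (1 + (b⁻¹ * v) ^ 4)) := fun v => by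
    field_simp
    ring
  simp only [hscale]
  rw [integral_const_mul, integral_comp_mul_left_Ioi (fun v : ℝ => 1 / (1 + v ^ 4)) 0
    (inv_pos.2 hb), mul_zero, integral_one_div_one_add_pow_four, smul_eq_mul]
  field_simp

theorem integral_sq_div_pow_four_add_pow_four {b : ℝ} (hb : 0 < b) :
    ∫ v in Ioi (0 : ℝ), v ^ 2 / (v ^ 4 + b ^ 4) = Real.pi / (2 * √2 * b) := by
  have hinv : ∀ v ∈ Ioi (0 : ℝ), (v ^ 2)⁻¹ * (v⁻¹ ^ 2 / (v⁻¹ ^ 4 + b ^ 4)) =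
      (b ^ 4)⁻¹ * (1 / (v ^ 4 + b⁻¹ ^ 4)) := fun v (hv : 0 < v) => by
    field_simp
    ring
  rw [integral_Ioi_eq_integral_inv, setIntegral_congr_fun measurableSet_Ioi hinv,
    integral_const_mul, integral_one_div_pow_four_add_pow_four (inv_pos.2 hb)]
  field_simp

theorem integrableOn_one_div_sq_add_sq {a : ℝ} (ha : 0 < a) :
    IntegrableOn (fun v : ℝ => 1 / (a ^ 2 + v ^ 2)) (Ioi 0) :=
  .of_integral_ne_zero (by rw [integral_one_div_sq_add_sq ha]; positivity)

theorem integrableOn_one_div_pow_four_add_pow_four {b : ℝ} (hb : 0 < b) :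
    IntegrableOn (fun v : ℝ => 1 / (v ^ 4 + b ^ 4)) (Ioi 0) :=
  .of_integral_ne_zero (by rw [integral_one_div_pow_four_add_pow_four hb]; positivity)

theorem integrableOn_sq_div_pow_four_add_pow_four {b : ℝ} (hb : 0 < b) :
    IntegrableOn (fun v : ℝ => v ^ 2 / (v ^ 4 + b ^ 4)) (Ioi 0) :=
  .of_integral_ne_zero (by rw [integral_sq_div_pow_four_add_pow_four hb]; positivity)

theorem integral_affine_sq_div_pow_four_add_pow_four {b : ℝ} (hb : 0 < b) (c d : ℝ) :
    ∫ v in Ioi (0 : ℝ), (c * (v ^ 2 / (v ^ 4 + b ^ 4)) + d * (1 / (v ^ 4 + b ^ 4))) =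
      Real.pi * (b ^ 2 * c + d) / (2 * √2 * b ^ 3) := by
  rw [integral_add ((integrableOn_sq_div_pow_four_add_pow_four hb).const_mul c)
      ((integrableOn_one_div_pow_four_add_pow_four hb).const_mul d),
    integral_const_mul, integral_const_mul, integral_sq_div_pow_four_add_pow_four hb,
    integral_one_div_pow_four_add_pow_four hb]
  field_simp

theorem integral_one_div_add_mul_add {a b : ℝ} (ha : 0 < a) (hb : 0 < b) (hab : a ≠ b) :
    ∫ u in Ioi (0 : ℝ), 1 / ((a + u) * (u + b)) = (Real.log a - Real.log b) / (a - b) := by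
  have hab' : a - b ≠ 0 := sub_ne_zero.2 hab
  have hderiv : ∀ u ∈ Ici (0 : ℝ), HasDerivAt
      (fun u => (a - b)⁻¹ * (Real.log (u + b) - Real.log (u + a)))
      (1 / ((a + u) * (u + b))) u := fun u (hu : 0 ≤ u) => by
    refine (((((hasDerivAt_id u).add_const b).log (by positivity)).sub
      (((hasDerivAt_id u).add_const a).log (by positivity))).const_mul _).congr_deriv ?_
    simp only [id]
    field_simp
    ring
  have hlim : Tendsto (fun u => (a - b)⁻¹ * (Real.log (u + b) - Real.log (u + a))) atTop
      (𝓝 ((a - b)⁻¹ * (0 - 0))) := by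
    refine Tendsto.const_mul _ (((Real.tendsto_log_comp_add_sub_log b).sub
      (Real.tendsto_log_comp_add_sub_log a)).congr fun u => ?_)
    ring
  rw [integral_Ioi_of_hasDerivAt_of_nonneg' hderiv
    (fun u (hu : 0 < u) => by positivity) hlim]
  simp only [zero_add]
  ring

end RationalIntegrals

section Kernels

/-- The kernel of the Stieltjes transform on the half-line. -/
noncomputable def stieltjesKernel (x t : ℝ) : ℝ := 1 / (x + t)

/-- The Stieltjes kernel in the variables `x²`, `t²`, scaled by `√(xt)` to act on the same `L₂`
space (up to a factor `2`, which is left out). Its square is the kernel of the inversion formula. -/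
noncomputable def sqStieltjesKernel (x t : ℝ) : ℝ := √(x * t) / (x ^ 2 + t ^ 2)

/-- The real part of `exp (iπ/4) / (x + i t)`, the Stieltjes kernel on a rotated ray. It arises by
partial fractions when the two kernels above are composed. -/
noncomputable def rotatedStieltjesKernel (x t : ℝ) : ℝ := (x + t) / (√2 * (x ^ 2 + t ^ 2))

theorem stieltjesKernel_comm (x t : ℝ) : stieltjesKernel x t = stieltjesKernel t x := by
  rw [stieltjesKernel, stieltjesKernel, add_comm]

theorem sqStieltjesKernel_comm (x t : ℝ) : sqStieltjesKernel x t = sqStieltjesKernel t x := by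
  rw [sqStieltjesKernel, sqStieltjesKernel, mul_comm, add_comm]

theorem rotatedStieltjesKernel_comm (x t : ℝ) :
    rotatedStieltjesKernel x t = rotatedStieltjesKernel t x := by
  rw [rotatedStieltjesKernel, rotatedStieltjesKernel, add_comm, add_comm (x ^ 2)]

theorem stieltjesKernel_nonneg {x t : ℝ} (hx : 0 ≤ x) (ht : 0 ≤ t) : 0 ≤ stieltjesKernel x t := by
  unfold stieltjesKernel
  positivity

theorem sqStieltjesKernel_nonneg (x t : ℝ) : 0 ≤ sqStieltjesKernel x t := by
  unfold sqStieltjesKernel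
  positivity

theorem rotatedStieltjesKernel_nonneg {x t : ℝ} (hx : 0 ≤ x) (ht : 0 ≤ t) :
    0 ≤ rotatedStieltjesKernel x t := by
  unfold rotatedStieltjesKernel
  positivity

theorem measurable_stieltjesKernel : Measurable (Function.uncurry stieltjesKernel) := by
  unfold stieltjesKernel Function.uncurry
  fun_prop

theorem measurable_sqStieltjesKernel : Measurable (Function.uncurry sqStieltjesKernel) := by
  unfold sqStieltjesKernel Function.uncurry
  fun_prop

theorem measurable_rotatedStieltjesKernel :
    Measurable (Function.uncurry rotatedStieltjesKernel) := by
  unfold rotatedStieltjesKernel Function.uncurry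
  fun_prop

theorem sqStieltjesKernel_sq_sq {a b : ℝ} (ha : 0 ≤ a) (hb : 0 ≤ b) :
    sqStieltjesKernel (a ^ 2) (b ^ 2) = a * b / (a ^ 4 + b ^ 4) := by
  rw [sqStieltjesKernel, ← mul_pow, Real.sqrt_sq (by positivity), ← pow_mul, ← pow_mul]

theorem sqStieltjesKernel_le_stieltjesKernel {x t : ℝ} (hx : 0 < x) (ht : 0 < t) :
    sqStieltjesKernel x t ≤ stieltjesKernel x t := by
  obtain ⟨a, ha, rfl⟩ : ∃ a, 0 < a ∧ a ^ 2 = x := ⟨√x, by positivity, Real.sq_sqrt hx.le⟩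
  obtain ⟨b, hb, rfl⟩ : ∃ b, 0 < b ∧ b ^ 2 = t := ⟨√t, by positivity, Real.sq_sqrt ht.le⟩
  rw [sqStieltjesKernel_sq_sq ha.le hb.le, stieltjesKernel,
    div_le_div_iff₀ (by positivity) (by positivity)]
  have hcube : 0 ≤ (a - b) ^ 2 * (a ^ 2 + a * b + b ^ 2) := by positivity
  linear_combination hcube

theorem integral_stieltjesKernel_div_sqrt {x : ℝ} (hx : 0 < x) :
    ∫ t in Ioi (0 : ℝ), stieltjesKernel x t / √t = Real.pi / √x := by
  obtain ⟨a, ha, rfl⟩ : ∃ a, 0 < a ∧ a ^ 2 = x := ⟨√x, by positivity, Real.sq_sqrt hx.le⟩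
  have hsq : ∀ v ∈ Ioi (0 : ℝ), 2 * v * (stieltjesKernel (a ^ 2) (v ^ 2) / √(v ^ 2)) =
      2 * (1 / (a ^ 2 + v ^ 2)) := fun v (hv : 0 < v) => by
    rw [stieltjesKernel, Real.sqrt_sq hv.le]
    field_simp
  rw [integral_Ioi_eq_integral_sq, setIntegral_congr_fun measurableSet_Ioi hsq,
    integral_const_mul, integral_one_div_sq_add_sq ha, Real.sqrt_sq ha.le]
  field_simp

theorem integral_sqStieltjesKernel_div_sqrt {x : ℝ} (hx : 0 < x) :
    ∫ t in Ioi (0 : ℝ), sqStieltjesKernel x t / √t = Real.pi / 2 / √x := by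
  have hsq : ∀ t ∈ Ioi (0 : ℝ), sqStieltjesKernel x t / √t = √x * (1 / (x ^ 2 + t ^ 2)) :=
    fun t (ht : 0 < t) => by
      rw [sqStieltjesKernel, Real.sqrt_mul hx.le]
      field_simp
  rw [setIntegral_congr_fun measurableSet_Ioi hsq, integral_const_mul,
    integral_one_div_sq_add_sq hx]
  field_simp
  exact Real.sq_sqrt hx.le

theorem integral_rotatedStieltjesKernel_div_sqrt {x : ℝ} (hx : 0 < x) :
    ∫ t in Ioi (0 : ℝ), rotatedStieltjesKernel x t / √t = Real.pi / √x := by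
  obtain ⟨a, ha, rfl⟩ : ∃ a, 0 < a ∧ a ^ 2 = x := ⟨√x, by positivity, Real.sq_sqrt hx.le⟩
  have hsq : ∀ v ∈ Ioi (0 : ℝ), 2 * v * (rotatedStieltjesKernel (a ^ 2) (v ^ 2) / √(v ^ 2)) =
      2 / √2 * (v ^ 2 / (v ^ 4 + a ^ 4)) + 2 / √2 * a ^ 2 * (1 / (v ^ 4 + a ^ 4)) :=
    fun v (hv : 0 < v) => by
      rw [rotatedStieltjesKernel, Real.sqrt_sq hv.le]
      field_simp
      ring
  rw [integral_Ioi_eq_integral_sq, setIntegral_congr_fun measurableSet_Ioi hsq,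
    integral_affine_sq_div_pow_four_add_pow_four ha, Real.sqrt_sq ha.le]
  field_simp
  norm_num

theorem integral_stieltjesKernel_mul_sqStieltjesKernel {x t : ℝ} (hx : 0 < x) (ht : 0 < t) :
    ∫ y in Ioi (0 : ℝ), stieltjesKernel x y * sqStieltjesKernel y t =
      Real.pi * (rotatedStieltjesKernel x t - sqStieltjesKernel x t) := by
  obtain ⟨a, ha, rfl⟩ : ∃ a, 0 < a ∧ a ^ 2 = x := ⟨√x, by positivity, Real.sq_sqrt hx.le⟩
  obtain ⟨b, hb, rfl⟩ : ∃ b, 0 < b ∧ b ^ 2 = t := ⟨√t, by positivity, Real.sq_sqrt ht.le⟩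
  have hpartial : ∀ v ∈ Ioi (0 : ℝ),
      2 * v * (stieltjesKernel (a ^ 2) (v ^ 2) * sqStieltjesKernel (v ^ 2) (b ^ 2)) =
        2 * b / (a ^ 4 + b ^ 4) * (a ^ 2 * (v ^ 2 / (v ^ 4 + b ^ 4)) +
          b ^ 4 * (1 / (v ^ 4 + b ^ 4)) - a ^ 2 * (1 / (a ^ 2 + v ^ 2))) := fun v (hv : 0 < v) => by
    rw [stieltjesKernel, sqStieltjesKernel_sq_sq hv.le hb.le]
    field_simp
    ring
  rw [integral_Ioi_eq_integral_sq, setIntegral_congr_fun measurableSet_Ioi hpartial,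
    integral_const_mul, integral_sub
      (((integrableOn_sq_div_pow_four_add_pow_four hb).const_mul _).fun_add
        ((integrableOn_one_div_pow_four_add_pow_four hb).const_mul _))
      ((integrableOn_one_div_sq_add_sq ha).const_mul _),
    integral_affine_sq_div_pow_four_add_pow_four hb, integral_const_mul,
    integral_one_div_sq_add_sq ha, rotatedStieltjesKernel, sqStieltjesKernel_sq_sq ha.le hb.le]
  field_simp

theorem integral_rotatedStieltjesKernel_mul_sqStieltjesKernel {x t : ℝ} (hx : 0 < x) (ht : 0 < t)
    (hxt : t ≠ x) :
    ∫ y in Ioi (0 : ℝ), rotatedStieltjesKernel x y * sqStieltjesKernel y t =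
      Real.pi / 2 * stieltjesKernel x t := by
  obtain ⟨a, ha, rfl⟩ : ∃ a, 0 < a ∧ a ^ 2 = x := ⟨√x, by positivity, Real.sq_sqrt hx.le⟩
  obtain ⟨b, hb, rfl⟩ : ∃ b, 0 < b ∧ b ^ 2 = t := ⟨√t, by positivity, Real.sq_sqrt ht.le⟩
  have hne : b ^ 2 - a ^ 2 ≠ 0 := sub_ne_zero.2 hxt
  have hpartial : ∀ v ∈ Ioi (0 : ℝ),
      2 * v * (rotatedStieltjesKernel (a ^ 2) (v ^ 2) * sqStieltjesKernel (v ^ 2) (b ^ 2)) =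
        2 * b / (√2 * ((b ^ 2 - a ^ 2) * (a ^ 2 + b ^ 2))) *
        ((a ^ 2 * (v ^ 2 / (v ^ 4 + a ^ 4)) + -a ^ 4 * (1 / (v ^ 4 + a ^ 4))) +
          (-a ^ 2 * (v ^ 2 / (v ^ 4 + b ^ 4)) + b ^ 4 * (1 / (v ^ 4 + b ^ 4)))) :=
    fun v (hv : 0 < v) => by
      have hva : v ^ 4 + a ^ 4 ≠ 0 := by positivity
      have hvb : v ^ 4 + b ^ 4 ≠ 0 := by positivity
      have hav : a ^ 4 + v ^ 4 ≠ 0 := by positivity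
      rw [rotatedStieltjesKernel, sqStieltjesKernel_sq_sq hv.le hb.le]
      field_simp
      ring
  rw [integral_Ioi_eq_integral_sq, setIntegral_congr_fun measurableSet_Ioi hpartial,
    integral_const_mul, integral_add
      (((integrableOn_sq_div_pow_four_add_pow_four ha).const_mul _).fun_add
        ((integrableOn_one_div_pow_four_add_pow_four ha).const_mul _))
      (((integrableOn_sq_div_pow_four_add_pow_four hb).const_mul _).fun_add
        ((integrableOn_one_div_pow_four_add_pow_four hb).const_mul _)),
    integral_affine_sq_div_pow_four_add_pow_four ha,
    integral_affine_sq_div_pow_four_add_pow_four hb, stieltjesKernel]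
  have h2 : √2 ^ 2 = 2 := Real.sq_sqrt zero_le_two
  field_simp
  rw [h2]
  ring

theorem integral_sqStieltjesKernel_mul_sqStieltjesKernel {x t : ℝ} (hx : 0 < x) (ht : 0 < t)
    (hxt : t ≠ x) :
    ∫ y in Ioi (0 : ℝ), sqStieltjesKernel x y * sqStieltjesKernel y t = logKernel x t := by
  have hsq : ∀ y ∈ Ioi (0 : ℝ), sqStieltjesKernel x y * sqStieltjesKernel y t =
      √(x * t) / 2 * (2 * y * (1 / ((x ^ 2 + y ^ 2) * (y ^ 2 + t ^ 2)))) :=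
    fun y (hy : 0 < y) => by
      have hsqrt : √(x * y) * √(y * t) = √(x * t) * y := by
        rw [← Real.sqrt_mul (by positivity), show x * y * (y * t) = x * t * y ^ 2 by ring,
          Real.sqrt_mul (by positivity), Real.sqrt_sq hy.le]
      rw [sqStieltjesKernel, sqStieltjesKernel, div_mul_div_comm, hsqrt]
      ring
  have hxt_sq : x ^ 2 ≠ t ^ 2 := fun h => hxt ((pow_left_inj₀ ht.le hx.le two_ne_zero).1 h.symm)
  rw [setIntegral_congr_fun measurableSet_Ioi hsq, integral_const_mul,
    ← integral_Ioi_eq_integral_sq (fun u => 1 / ((x ^ 2 + u) * (u + t ^ 2))),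
    integral_one_div_add_mul_add (by positivity) (by positivity) hxt_sq, Real.log_pow,
    Real.log_pow, logKernel]
  push_cast
  ring

end Kernels

section SchurTest

theorem lintegral_mul_sq_le {α : Type*} [MeasurableSpace α] {μ : Measure α} {k w g : α → ℝ≥0∞}
    (hk : AEMeasurable k μ) (hw : AEMeasurable w μ) (hg : AEMeasurable g μ)
    (hw0 : ∀ᵐ t ∂μ, w t ≠ 0) (hwtop : ∀ᵐ t ∂μ, w t ≠ ∞) :
    (∫⁻ t, k t * g t ∂μ) ^ 2 ≤ (∫⁻ t, k t * w t ∂μ) * ∫⁻ t, k t * ((w t)⁻¹ * g t ^ 2) ∂μ := by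
  have hsq : ∀ a : ℝ≥0∞, (a ^ (1 / 2 : ℝ)) ^ 2 = a := fun a => by
    rw [← ENNReal.rpow_two, ← ENNReal.rpow_mul]
    norm_num
  have hsplit : ∫⁻ t, k t * g t ∂μ =
      ∫⁻ t, (k t * w t) ^ (1 / 2 : ℝ) * (k t * ((w t)⁻¹ * g t ^ 2)) ^ (1 / 2 : ℝ) ∂μ := by
    refine lintegral_congr_ae ?_
    filter_upwards [hw0, hwtop] with t ht0 httop
    have hfactor : k t * w t * (k t * ((w t)⁻¹ * g t ^ 2)) = (k t * g t) ^ 2 := by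
      rw [show k t * w t * (k t * ((w t)⁻¹ * g t ^ 2)) =
        w t * (w t)⁻¹ * (k t * g t) ^ 2 by ring, ENNReal.mul_inv_cancel ht0 httop, one_mul]
    rw [← ENNReal.mul_rpow_of_nonneg _ _ (by norm_num), hfactor, ← ENNReal.rpow_two,
      ← ENNReal.rpow_mul]
    norm_num
  calc (∫⁻ t, k t * g t ∂μ) ^ 2
      ≤ ((∫⁻ t, k t * w t ∂μ) ^ (1 / 2 : ℝ) *
          (∫⁻ t, k t * ((w t)⁻¹ * g t ^ 2) ∂μ) ^ (1 / 2 : ℝ)) ^ 2 := by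
        rw [hsplit]
        gcongr
        exact ENNReal.lintegral_mul_norm_pow_le (hk.mul hw)
          (hk.mul (hw.inv.mul (hg.pow_const 2))) (by norm_num) (by norm_num) (by norm_num)
    _ = _ := by rw [mul_pow, hsq, hsq]

theorem eLpNorm_two_sq {α E : Type*} [MeasurableSpace α] [NormedAddCommGroup E] (f : α → E)
    (μ : Measure α) : eLpNorm f 2 μ ^ 2 = ∫⁻ x, ‖f x‖ₑ ^ 2 ∂μ := by
  simpa using eLpNorm_nnreal_pow_eq_lintegral (p := 2) (f := f) (μ := μ) two_ne_zero

variable {α β γ 𝕜 : Type*} [MeasurableSpace α] [MeasurableSpace β] [MeasurableSpace γ] [RCLike 𝕜]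

/-- The hypotheses of the Schur test, with weights `p` and `q`: the integral operator with kernel
`K` is then bounded from `L₂(ν)` to `L₂(μ)` with norm at most `C`. The weights take extended values
so that the two inequalities can be stated with Lebesgue integrals. -/
structure IsSchurKernel (K : α → β → 𝕜) (p : α → ℝ≥0∞) (q : β → ℝ≥0∞) (C : ℝ≥0)
    (μ : Measure α) (ν : Measure β) : Prop where
  measurable : Measurable (Function.uncurry K)
  measurable_left : Measurable p
  measurable_right : Measurable q
  ae_ne_zero : ∀ᵐ t ∂ν, q t ≠ 0
  ae_ne_top : ∀ᵐ t ∂ν, q t ≠ ∞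
  lintegral_right_le : ∀ᵐ x ∂μ, ∫⁻ t, ‖K x t‖ₑ * q t ∂ν ≤ C * p x
  lintegral_left_le : ∀ᵐ t ∂ν, ∫⁻ x, ‖K x t‖ₑ * p x ∂μ ≤ C * q t

namespace IsSchurKernel

variable {K K' : α → β → 𝕜} {p : α → ℝ≥0∞} {q : β → ℝ≥0∞} {C C' : ℝ≥0} {μ : Measure α}
  {ν : Measure β}

theorem norm (h : IsSchurKernel K p q C μ ν) :
    IsSchurKernel (fun x t => ‖K x t‖) p q C μ ν where
  measurable := h.measurable.norm
  measurable_left := h.measurable_left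
  measurable_right := h.measurable_right
  ae_ne_zero := h.ae_ne_zero
  ae_ne_top := h.ae_ne_top
  lintegral_right_le := by simpa only [enorm_norm] using h.lintegral_right_le
  lintegral_left_le := by simpa only [enorm_norm] using h.lintegral_left_le

theorem const_mul (h : IsSchurKernel K p q C μ ν) (c : 𝕜) :
    IsSchurKernel (fun x t => c * K x t) p q (‖c‖₊ * C) μ ν where
  measurable := h.measurable.const_mul c
  measurable_left := h.measurable_left
  measurable_right := h.measurable_right
  ae_ne_zero := h.ae_ne_zero
  ae_ne_top := h.ae_ne_top
  lintegral_right_le := h.lintegral_right_le.mono fun x hx => by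
    simp only [enorm_mul, mul_assoc]
    rw [lintegral_const_mul' _ _ enorm_ne_top, ENNReal.coe_mul, mul_assoc]
    exact mul_le_mul_right hx _
  lintegral_left_le := h.lintegral_left_le.mono fun t ht => by
    simp only [enorm_mul, mul_assoc]
    rw [lintegral_const_mul' _ _ enorm_ne_top, ENNReal.coe_mul, mul_assoc]
    exact mul_le_mul_right ht _

theorem measurable_section (h : IsSchurKernel K p q C μ ν) (x : α) : Measurable (K x) :=
  h.measurable.comp measurable_prodMk_left

theorem measurable_section_left (h : IsSchurKernel K p q C μ ν) (t : β) :
    Measurable fun x => K x t :=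
  h.measurable.comp measurable_prodMk_right

theorem sub (h : IsSchurKernel K p q C μ ν) (h' : IsSchurKernel K' p q C' μ ν) :
    IsSchurKernel (fun x t => K x t - K' x t) p q (C + C') μ ν where
  measurable := h.measurable.sub h'.measurable
  measurable_left := h.measurable_left
  measurable_right := h.measurable_right
  ae_ne_zero := h.ae_ne_zero
  ae_ne_top := h.ae_ne_top
  lintegral_right_le := by
    filter_upwards [h.lintegral_right_le, h'.lintegral_right_le] with x hx hx'
    calc ∫⁻ t, ‖K x t - K' x t‖ₑ * q t ∂ν
        ≤ ∫⁻ t, (‖K x t‖ₑ * q t + ‖K' x t‖ₑ * q t) ∂ν := by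
          refine lintegral_mono fun t => ?_
          rw [← add_mul]
          exact mul_le_mul_left enorm_sub_le _
      _ = ∫⁻ t, ‖K x t‖ₑ * q t ∂ν + ∫⁻ t, ‖K' x t‖ₑ * q t ∂ν :=
          lintegral_add_left ((h.measurable_section x).enorm.mul h.measurable_right) _
      _ ≤ C * p x + C' * p x := add_le_add hx hx'
      _ = ((C + C' : ℝ≥0) : ℝ≥0∞) * p x := by rw [ENNReal.coe_add, add_mul]
  lintegral_left_le := by
    filter_upwards [h.lintegral_left_le, h'.lintegral_left_le] with t ht ht'
    calc ∫⁻ x, ‖K x t - K' x t‖ₑ * p x ∂μ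
        ≤ ∫⁻ x, (‖K x t‖ₑ * p x + ‖K' x t‖ₑ * p x) ∂μ := by
          refine lintegral_mono fun x => ?_
          rw [← add_mul]
          exact mul_le_mul_left enorm_sub_le _
      _ = ∫⁻ x, ‖K x t‖ₑ * p x ∂μ + ∫⁻ x, ‖K' x t‖ₑ * p x ∂μ :=
          lintegral_add_left ((h.measurable_section_left t).enorm.mul h.measurable_left) _
      _ ≤ C * q t + C' * q t := add_le_add ht ht'
      _ = ((C + C' : ℝ≥0) : ℝ≥0∞) * q t := by rw [ENNReal.coe_add, add_mul]

variable {f : β → 𝕜}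

theorem aestronglyMeasurable_mul (h : IsSchurKernel K p q C μ ν)
    (hf : AEStronglyMeasurable f ν) :
    AEStronglyMeasurable (fun z : α × β => K z.1 z.2 * f z.2) (μ.prod ν) :=
  h.measurable.aestronglyMeasurable.mul hf.comp_snd

variable [SFinite μ] [SFinite ν]

theorem lintegral_lintegral_sq_le (h : IsSchurKernel K p q C μ ν) {g : β → ℝ≥0∞}
    (hg : AEMeasurable g ν) :
    ∫⁻ x, (∫⁻ t, ‖K x t‖ₑ * g t ∂ν) ^ 2 ∂μ ≤ C ^ 2 * ∫⁻ t, g t ^ 2 ∂ν := by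
  have hp := h.measurable_left
  have hq := h.measurable_right
  have hmeas : AEMeasurable (Function.uncurry fun x t =>
      ‖K x t‖ₑ * p x * ((q t)⁻¹ * g t ^ 2)) (μ.prod ν) :=
    (h.measurable.enorm.mul (hp.comp measurable_fst)).aemeasurable.mul
      ((hq.inv.comp measurable_snd).aemeasurable.mul (hg.comp_snd.pow_const 2))
  calc ∫⁻ x, (∫⁻ t, ‖K x t‖ₑ * g t ∂ν) ^ 2 ∂μ
      ≤ ∫⁻ x, C * ∫⁻ t, ‖K x t‖ₑ * p x * ((q t)⁻¹ * g t ^ 2) ∂ν ∂μ := by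
        refine lintegral_mono_ae (h.lintegral_right_le.mono fun x hx => ?_)
        have hK := (h.measurable_section x).enorm
        refine (lintegral_mul_sq_le hK.aemeasurable hq.aemeasurable hg h.ae_ne_zero
          h.ae_ne_top).trans ((mul_le_mul_left hx _).trans_eq ?_)
        have hint : AEMeasurable (fun t => ‖K x t‖ₑ * ((q t)⁻¹ * g t ^ 2)) ν :=
          hK.aemeasurable.mul (hq.inv.aemeasurable.mul (hg.pow_const 2))
        rw [mul_assoc, ← lintegral_const_mul'' _ hint]
        simp only [mul_assoc, mul_left_comm (p x)]
    _ = C * ∫⁻ t, ∫⁻ x, ‖K x t‖ₑ * p x * ((q t)⁻¹ * g t ^ 2) ∂μ ∂ν := by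
        rw [lintegral_const_mul' _ _ ENNReal.coe_ne_top, lintegral_lintegral_swap hmeas]
    _ ≤ C * ∫⁻ t, C * g t ^ 2 ∂ν := by
        gcongr C * ?_
        refine lintegral_mono_ae ?_
        filter_upwards [h.lintegral_left_le, h.ae_ne_zero, h.ae_ne_top] with t ht ht0 httop
        have hint : Measurable fun x => ‖K x t‖ₑ * p x :=
          (h.measurable_section_left t).enorm.mul hp
        rw [lintegral_mul_const _ hint]
        refine (mul_le_mul_left ht _).trans_eq ?_
        rw [mul_assoc, ← mul_assoc (q t), ENNReal.mul_inv_cancel ht0 httop, one_mul]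
    _ = C ^ 2 * ∫⁻ t, g t ^ 2 ∂ν := by
        rw [lintegral_const_mul' _ _ ENNReal.coe_ne_top, sq, mul_assoc]

theorem ae_integrable_mul (h : IsSchurKernel K p q C μ ν) (hf : MemLp f 2 ν) :
    ∀ᵐ x ∂μ, Integrable (fun t => K x t * f t) ν := by
  have hfin : ∫⁻ x, (∫⁻ t, ‖K x t‖ₑ * ‖f t‖ₑ ∂ν) ^ 2 ∂μ ≠ ∞ := by
    refine ((h.lintegral_lintegral_sq_le hf.1.enorm).trans_lt ?_).ne
    refine ENNReal.mul_lt_top (by finiteness) ?_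
    simpa using (lintegral_rpow_enorm_lt_top_of_eLpNorm_lt_top (by norm_num) (by norm_num) hf.2)
  have hmeas : AEMeasurable (fun x => (∫⁻ t, ‖K x t‖ₑ * ‖f t‖ₑ ∂ν) ^ 2) μ :=
    ((h.measurable.enorm.aemeasurable.mul hf.1.enorm.comp_snd).lintegral_prod_right').pow_const 2
  filter_upwards [ae_lt_top' hmeas hfin] with x hx
  refine ⟨(h.measurable_section x).aestronglyMeasurable.mul hf.1, ?_⟩
  simpa only [HasFiniteIntegral, enorm_mul, ENNReal.pow_lt_top_iff, OfNat.ofNat_ne_zero,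
    or_false] using hx

theorem eLpNorm_integral_le (h : IsSchurKernel K p q C μ ν) (hf : AEStronglyMeasurable f ν) :
    eLpNorm (fun x => ∫ t, K x t * f t ∂ν) 2 μ ≤ C * eLpNorm f 2 ν := by
  rw [← ENNReal.pow_le_pow_left_iff two_ne_zero, mul_pow,
    eLpNorm_two_sq, eLpNorm_two_sq]
  refine (lintegral_mono fun x => ?_).trans (h.lintegral_lintegral_sq_le hf.enorm)
  simp only [← enorm_mul]
  gcongr
  exact enorm_integral_le_lintegral_enorm _

theorem memLp_integral (h : IsSchurKernel K p q C μ ν) (hf : MemLp f 2 ν) :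
    MemLp (fun x => ∫ t, K x t * f t ∂ν) 2 μ :=
  ⟨(h.aestronglyMeasurable_mul hf.1).integral_prod_right',
    (h.eLpNorm_integral_le hf.1).trans_lt (ENNReal.mul_lt_top ENNReal.coe_lt_top hf.2)⟩

/-- The bounded operator `L₂(ν) → L₂(μ)` whose integral kernel is a given Schur kernel. -/
noncomputable def op (h : IsSchurKernel K p q C μ ν) : Lp 𝕜 2 ν →L[𝕜] Lp 𝕜 2 μ :=
  LinearMap.mkContinuous
    { toFun := fun f => (h.memLp_integral (Lp.memLp f)).toLp _
      map_add' := fun f g => by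
        rw [← MemLp.toLp_add, MemLp.toLp_eq_toLp_iff]
        filter_upwards [h.ae_integrable_mul (Lp.memLp f), h.ae_integrable_mul (Lp.memLp g)]
          with x hf hg
        rw [Pi.add_apply, ← integral_add hf hg]
        refine integral_congr_ae ((Lp.coeFn_add f g).mono fun t ht => ?_)
        simp only [ht, Pi.add_apply, mul_add]
      map_smul' := fun c f => by
        rw [← MemLp.toLp_const_smul, MemLp.toLp_eq_toLp_iff]
        refine ae_of_all _ fun x => ?_
        rw [RingHom.id_apply, Pi.smul_apply, ← integral_smul]
        refine integral_congr_ae ((Lp.coeFn_smul c f).mono fun t ht => ?_)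
        simp only [ht, Pi.smul_apply, smul_eq_mul, mul_left_comm] } C fun f => by
    simp only [LinearMap.coe_mk, AddHom.coe_mk, Lp.norm_toLp]
    rw [Lp.norm_def, ← ENNReal.coe_toReal, ← ENNReal.toReal_mul]
    exact ENNReal.toReal_mono (ENNReal.mul_ne_top ENNReal.coe_ne_top (Lp.eLpNorm_ne_top f))
      (h.eLpNorm_integral_le (Lp.aestronglyMeasurable f))

theorem coeFn_op (h : IsSchurKernel K p q C μ ν) (f : Lp 𝕜 2 ν) :
    h.op f =ᵐ[μ] fun x => ∫ t, K x t * f t ∂ν :=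
  MemLp.coeFn_toLp (h.memLp_integral (Lp.memLp f))

theorem norm_op_le (h : IsSchurKernel K p q C μ ν) : ‖h.op‖ ≤ C :=
  LinearMap.mkContinuous_norm_le _ C.2 _

theorem eq_op (h : IsSchurKernel K p q C μ ν) {T : Lp 𝕜 2 ν →L[𝕜] Lp 𝕜 2 μ}
    (hT : ∀ f, T f =ᵐ[μ] fun x => ∫ t, K x t * f t ∂ν) : T = h.op :=
  ContinuousLinearMap.ext fun f => Lp.ext ((hT f).trans (h.coeFn_op f).symm)

theorem op_const_mul (h : IsSchurKernel K p q C μ ν) (c : 𝕜) :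
    (h.const_mul c).op = c • h.op := by
  refine ((h.const_mul c).eq_op fun f => ?_).symm
  filter_upwards [Lp.coeFn_smul c (h.op f), h.coeFn_op f] with x hsmul hop
  rw [smul_apply, hsmul, Pi.smul_apply, hop, smul_eq_mul, ← integral_const_mul]
  simp only [mul_assoc]

theorem op_sub (h : IsSchurKernel K p q C μ ν) (h' : IsSchurKernel K' p q C' μ ν) :
    (h.sub h').op = h.op - h'.op := by
  refine ((h.sub h').eq_op fun f => ?_).symm
  filter_upwards [Lp.coeFn_sub (h.op f) (h'.op f), h.coeFn_op f, h'.coeFn_op f,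
    h.ae_integrable_mul (Lp.memLp f), h'.ae_integrable_mul (Lp.memLp f)]
    with x hsub hop hop' hint hint'
  rw [sub_apply, hsub, Pi.sub_apply, hop, hop', ← integral_sub hint hint']
  simp only [sub_mul]

section Composition

variable {L : β → γ → 𝕜} {r : γ → ℝ≥0∞} {D : ℝ≥0} {ρ : Measure γ} [SFinite ρ] {k : β → 𝕜}
  {f : γ → 𝕜}

theorem integrable_mul_mul (h : IsSchurKernel L q r D ν ρ) (hk : AEStronglyMeasurable k ν)
    (hf : MemLp f 2 ρ) (hint : Integrable (fun y => ‖k y‖ * ∫ t, ‖L y t‖ * ‖f t‖ ∂ρ) ν) :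
    Integrable (fun z : β × γ => k z.1 * (L z.1 z.2 * f z.2)) (ν.prod ρ) := by
  have hmeas : AEStronglyMeasurable (fun z : β × γ => k z.1 * (L z.1 z.2 * f z.2)) (ν.prod ρ) :=
    hk.comp_fst.mul (h.aestronglyMeasurable_mul hf.1)
  rw [integrable_prod_iff hmeas]
  refine ⟨(h.ae_integrable_mul hf).mono fun y hy => hy.const_mul (k y), hint.congr ?_⟩
  refine ae_of_all _ fun y => ?_
  simp only [norm_mul, integral_const_mul]

theorem integrable_integral_mul_mul (h : IsSchurKernel L q r D ν ρ)
    (hk : AEStronglyMeasurable k ν) (hf : MemLp f 2 ρ)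
    (hint : Integrable (fun y => ‖k y‖ * ∫ t, ‖L y t‖ * ‖f t‖ ∂ρ) ν) :
    Integrable (fun t => (∫ y, k y * L y t ∂ν) * f t) ρ := by
  simpa only [← mul_assoc, integral_mul_const] using
    (h.integrable_mul_mul hk hf hint).integral_prod_right

theorem integral_mul_integral_mul (h : IsSchurKernel L q r D ν ρ)
    (hk : AEStronglyMeasurable k ν) (hf : MemLp f 2 ρ)
    (hint : Integrable (fun y => ‖k y‖ * ∫ t, ‖L y t‖ * ‖f t‖ ∂ρ) ν) :
    ∫ y, k y * ∫ t, L y t * f t ∂ρ ∂ν = ∫ t, (∫ y, k y * L y t ∂ν) * f t ∂ρ := by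
  simp only [← integral_const_mul, ← integral_mul_const, mul_assoc]
  exact integral_integral_swap (h.integrable_mul_mul hk hf hint)

theorem coeFn_op_op (h : IsSchurKernel K p q C μ ν) (h' : IsSchurKernel L q r D ν ρ)
    (f : Lp 𝕜 2 ρ) :
    h.op (h'.op f) =ᵐ[μ] fun x => ∫ t, (∫ y, K x y * L y t ∂ν) * f t ∂ρ := by
  have hnorm := h.norm.ae_integrable_mul (h'.norm.memLp_integral (Lp.memLp f).norm)
  filter_upwards [h.coeFn_op (h'.op f), hnorm] with x hx hint
  rw [hx, ← h'.integral_mul_integral_mul (h.measurable_section x).aestronglyMeasurable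
    (Lp.memLp f) hint]
  refine integral_congr_ae ((h'.coeFn_op f).mono fun y hy => ?_)
  simp only [hy]

theorem op_comp_op {M : α → γ → 𝕜} {p' : α → ℝ≥0∞} {r' : γ → ℝ≥0∞} {E : ℝ≥0}
    (h : IsSchurKernel K p q C μ ν) (h' : IsSchurKernel L q r D ν ρ)
    (hM : IsSchurKernel M p' r' E μ ρ)
    (hcomp : ∀ᵐ x ∂μ, ∀ᵐ t ∂ρ, ∫ y, K x y * L y t ∂ν = M x t) :
    h.op ∘L h'.op = hM.op := by
  refine hM.eq_op fun f => ?_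
  filter_upwards [h.coeFn_op_op h' f, hcomp] with x hx hcompx
  rw [ContinuousLinearMap.comp_apply, hx]
  refine integral_congr_ae (hcompx.mono fun t ht => ?_)
  simp only [ht]

end Composition

end IsSchurKernel

end SchurTest

section HalfLine

theorem ae_halfLine_pos : ∀ᵐ x ∂halfLine, 0 < x := ae_restrict_mem measurableSet_Ioi

theorem ae_halfLine_ne (x : ℝ) : ∀ᵐ t ∂halfLine, t ≠ x :=
  ae_restrict_of_ae (Measure.ae_ne volume x)

/-- The weight `t ^ (-1 / 2)` of the Schur test on the half-line: kernels that are homogeneous of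
degree `-1` map it to multiples of itself. -/
noncomputable def invSqrtWeight (t : ℝ) : ℝ≥0∞ := ENNReal.ofReal (√t)⁻¹

theorem isSchurKernel_invSqrtWeight {K : ℝ → ℝ → ℝ} {C : ℝ≥0} (hC : 0 < C)
    (hmeas : Measurable (Function.uncurry K)) (hcomm : ∀ x t, K x t = K t x)
    (hnonneg : ∀ x t, 0 < x → 0 < t → 0 ≤ K x t)
    (hint : ∀ x, 0 < x → ∫ t in Ioi (0 : ℝ), K x t / √t = C / √x) :
    IsSchurKernel (fun x t => (K x t : ℂ)) invSqrtWeight invSqrtWeight C halfLine halfLine := by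
  have hweight : Measurable invSqrtWeight := Real.continuous_sqrt.measurable.inv.ennreal_ofReal
  have hright : ∀ᵐ x ∂halfLine,
      ∫⁻ t, ‖(K x t : ℂ)‖ₑ * invSqrtWeight t ∂halfLine ≤ C * invSqrtWeight x := by
    filter_upwards [ae_halfLine_pos] with x hx
    have hpos : 0 < ∫ t in Ioi (0 : ℝ), K x t / √t := by
      rw [hint x hx]
      positivity
    have hcongr : ∀ᵐ t ∂halfLine,
        ‖(K x t : ℂ)‖ₑ * invSqrtWeight t = ENNReal.ofReal (K x t / √t) := by
      filter_upwards [ae_halfLine_pos] with t ht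
      rw [← ofReal_norm, Complex.norm_real, Real.norm_of_nonneg (hnonneg x t hx ht),
        invSqrtWeight, ← ENNReal.ofReal_mul (hnonneg x t hx ht), ← div_eq_mul_inv]
    rw [lintegral_congr_ae hcongr, ← ofReal_integral_eq_lintegral_ofReal
      (.of_integral_ne_zero hpos.ne') (ae_halfLine_pos.mono fun t ht =>
        div_nonneg (hnonneg x t hx ht) t.sqrt_nonneg), hint x hx, invSqrtWeight, div_eq_mul_inv,
      ENNReal.ofReal_mul C.coe_nonneg, ENNReal.ofReal_coe_nnreal]
  exact {
    measurable := Complex.measurable_ofReal.comp hmeas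
    measurable_left := hweight
    measurable_right := hweight
    ae_ne_zero := ae_halfLine_pos.mono fun t ht => by
      simpa only [invSqrtWeight, ne_eq, ENNReal.ofReal_eq_zero, not_le, inv_pos, Real.sqrt_pos]
    ae_ne_top := ae_of_all _ fun _ => ENNReal.ofReal_ne_top
    lintegral_right_le := hright
    lintegral_left_le := by simpa only [hcomm] using hright }

theorem isSchurKernel_stieltjesKernel : IsSchurKernel (fun x t => (stieltjesKernel x t : ℂ))
    invSqrtWeight invSqrtWeight NNReal.pi halfLine halfLine :=
  isSchurKernel_invSqrtWeight NNReal.pi_pos measurable_stieltjesKernel stieltjesKernel_comm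
    (fun _ _ hx ht => stieltjesKernel_nonneg hx.le ht.le)
    fun _ => integral_stieltjesKernel_div_sqrt

theorem isSchurKernel_sqStieltjesKernel : IsSchurKernel (fun x t => (sqStieltjesKernel x t : ℂ))
    invSqrtWeight invSqrtWeight (NNReal.pi / 2) halfLine halfLine :=
  isSchurKernel_invSqrtWeight (half_pos NNReal.pi_pos) measurable_sqStieltjesKernel
    sqStieltjesKernel_comm (fun x t _ _ => sqStieltjesKernel_nonneg x t)
    fun _ => integral_sqStieltjesKernel_div_sqrt

theorem isSchurKernel_rotatedStieltjesKernel :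
    IsSchurKernel (fun x t => (rotatedStieltjesKernel x t : ℂ)) invSqrtWeight invSqrtWeight
      NNReal.pi halfLine halfLine :=
  isSchurKernel_invSqrtWeight NNReal.pi_pos measurable_rotatedStieltjesKernel
    rotatedStieltjesKernel_comm (fun _ _ hx ht => rotatedStieltjesKernel_nonneg hx.le ht.le)
    fun _ => integral_rotatedStieltjesKernel_div_sqrt

theorem memLp_stieltjesKernel {x : ℝ} (hx : 0 < x) :
    MemLp (fun t => (stieltjesKernel x t : ℂ)) 2 halfLine := by
  rw [memLp_two_iff_integrable_sq_norm
    (isSchurKernel_stieltjesKernel.measurable_section x).aestronglyMeasurable]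
  refine (integrableOn_add_rpow_Ioi_of_lt (a := -2) (m := x) (by norm_num) (neg_lt_zero.2 hx)).congr
    (ae_halfLine_pos.mono fun t ht => ?_)
  simp only [Complex.norm_real, Real.norm_eq_abs, sq_abs]
  rw [stieltjesKernel, Real.rpow_neg (by positivity), Real.rpow_two, one_div, inv_pow, add_comm]

theorem memLp_sqStieltjesKernel {x : ℝ} (hx : 0 < x) :
    MemLp (fun t => (sqStieltjesKernel x t : ℂ)) 2 halfLine := by
  refine (memLp_stieltjesKernel hx).mono
    (isSchurKernel_sqStieltjesKernel.measurable_section x).aestronglyMeasurable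
    (ae_halfLine_pos.mono fun t ht => ?_)
  rw [Complex.norm_real, Complex.norm_real, Real.norm_of_nonneg (sqStieltjesKernel_nonneg x t),
    Real.norm_of_nonneg (stieltjesKernel_nonneg hx.le ht.le)]
  exact sqStieltjesKernel_le_stieltjesKernel hx ht

theorem integrable_logKernel_mul {f : ℝ → ℂ} (hf : MemLp f 2 halfLine) {x : ℝ} (hx : 0 < x) :
    Integrable (fun t => (logKernel x t : ℂ) * f t) halfLine := by
  have hnorm := isSchurKernel_sqStieltjesKernel.norm.memLp_integral hf.norm
  refine (isSchurKernel_sqStieltjesKernel.integrable_integral_mul_mul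
    (memLp_sqStieltjesKernel hx).1 hf ((memLp_sqStieltjesKernel hx).norm.integrable_mul
      hnorm)).congr ?_
  filter_upwards [ae_halfLine_pos, ae_halfLine_ne x] with t ht htx
  rw [← integral_sqStieltjesKernel_mul_sqStieltjesKernel hx ht htx, ← integral_complex_ofReal]
  simp only [Complex.ofReal_mul]

end HalfLine

section Operators

/-- The Stieltjes transform on `L₂(ℝ₊)`. -/
noncomputable def stieltjesOp : L2HalfLine →L[ℂ] L2HalfLine := isSchurKernel_stieltjesKernel.op

/-- The integral operator on `L₂(ℝ₊)` with kernel `sqStieltjesKernel`. -/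
noncomputable def sqStieltjesOp : L2HalfLine →L[ℂ] L2HalfLine :=
  isSchurKernel_sqStieltjesKernel.op

/-- The integral operator on `L₂(ℝ₊)` with kernel `rotatedStieltjesKernel`. -/
noncomputable def rotatedStieltjesOp : L2HalfLine →L[ℂ] L2HalfLine :=
  isSchurKernel_rotatedStieltjesKernel.op

theorem norm_stieltjesOp_le : ‖stieltjesOp‖ ≤ Real.pi := isSchurKernel_stieltjesKernel.norm_op_le

theorem norm_sqStieltjesOp_le : ‖sqStieltjesOp‖ ≤ Real.pi / 2 :=
  isSchurKernel_sqStieltjesKernel.norm_op_le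

theorem stieltjesOp_mul_sqStieltjesOp :
    stieltjesOp * sqStieltjesOp = (Real.pi : ℂ) • (rotatedStieltjesOp - sqStieltjesOp) := by
  rw [rotatedStieltjesOp, sqStieltjesOp, ← IsSchurKernel.op_sub, ← IsSchurKernel.op_const_mul]
  refine isSchurKernel_stieltjesKernel.op_comp_op _ _ ?_
  filter_upwards [ae_halfLine_pos] with x hx
  filter_upwards [ae_halfLine_pos] with t ht
  simp only [← Complex.ofReal_mul, ← Complex.ofReal_sub]
  rw [integral_complex_ofReal, integral_stieltjesKernel_mul_sqStieltjesKernel hx ht]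

theorem rotatedStieltjesOp_mul_sqStieltjesOp :
    rotatedStieltjesOp * sqStieltjesOp = ((Real.pi / 2 : ℝ) : ℂ) • stieltjesOp := by
  rw [stieltjesOp, ← IsSchurKernel.op_const_mul]
  refine isSchurKernel_rotatedStieltjesKernel.op_comp_op _ _ ?_
  filter_upwards [ae_halfLine_pos] with x hx
  filter_upwards [ae_halfLine_pos, ae_halfLine_ne x] with t ht htx
  simp only [← Complex.ofReal_mul]
  rw [integral_complex_ofReal, integral_rotatedStieltjesKernel_mul_sqStieltjesKernel hx ht htx]

theorem coeFn_sqStieltjesOp_sqStieltjesOp (f : L2HalfLine) :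
    sqStieltjesOp (sqStieltjesOp f) =ᵐ[halfLine]
      fun x => ∫ t in Ioi (0 : ℝ), (logKernel x t : ℂ) * f t := by
  filter_upwards [isSchurKernel_sqStieltjesKernel.coeFn_op_op isSchurKernel_sqStieltjesKernel f,
    ae_halfLine_pos] with x hop hx
  rw [sqStieltjesOp, hop]
  refine integral_congr_ae ?_
  filter_upwards [ae_halfLine_pos, ae_halfLine_ne x] with t ht htx
  simp only [← Complex.ofReal_mul]
  rw [integral_complex_ofReal, integral_sqStieltjesKernel_mul_sqStieltjesKernel hx ht htx]

/-- The operator `2 + (2 / π) S`, with `S` the Stieltjes transform, which turns out to be the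
iterated half-Hartley transform. -/
noncomputable def hartleySqOp : L2HalfLine →L[ℂ] L2HalfLine :=
  (2 : ℂ) • 1 + (2 / Real.pi : ℂ) • stieltjesOp

/-- The operator of the inversion formula. -/
noncomputable def hartleySqInvOp : L2HalfLine →L[ℂ] L2HalfLine :=
  (1 / 2 : ℂ) • 1 - (1 / Real.pi ^ 2 : ℂ) • (sqStieltjesOp * sqStieltjesOp)

theorem hartleySqOp_mul_hartleySqInvOp : hartleySqOp * hartleySqInvOp = 1 := by
  have hcube : stieltjesOp * (sqStieltjesOp * sqStieltjesOp) =
      (Real.pi : ℂ) • (((Real.pi / 2 : ℝ) : ℂ) • stieltjesOp - sqStieltjesOp * sqStieltjesOp) := by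
    rw [← mul_assoc, stieltjesOp_mul_sqStieltjesOp, smul_mul_assoc, sub_mul,
      rotatedStieltjesOp_mul_sqStieltjesOp]
  have hpi : (Real.pi : ℂ) ≠ 0 := Complex.ofReal_ne_zero.2 Real.pi_ne_zero
  rw [hartleySqOp, hartleySqInvOp]
  simp only [add_mul, mul_sub, smul_mul_assoc, mul_smul_comm, one_mul, mul_one, hcube]
  push_cast
  match_scalars <;> field_simp <;> ring

theorem norm_hartleySqOp_le : ‖hartleySqOp‖ ≤ 4 := by
  have hone : ‖(1 : L2HalfLine →L[ℂ] L2HalfLine)‖ ≤ 1 := ContinuousLinearMap.norm_id_le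
  calc ‖hartleySqOp‖
      ≤ 2 * 1 + 2 / Real.pi * Real.pi := by
        refine (norm_add_le _ _).trans (add_le_add ?_ ?_)
        · simpa [norm_smul] using hone
        · simpa [norm_smul, abs_of_pos Real.pi_pos] using
            mul_le_mul_of_nonneg_left norm_stieltjesOp_le (by positivity : 0 ≤ 2 / Real.pi)
    _ = 4 := by
        field_simp
        norm_num

theorem norm_hartleySqInvOp_le : ‖hartleySqInvOp‖ ≤ 1 := by
  have hone : ‖(1 : L2HalfLine →L[ℂ] L2HalfLine)‖ ≤ 1 := ContinuousLinearMap.norm_id_le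
  have hsq : ‖sqStieltjesOp * sqStieltjesOp‖ ≤ Real.pi / 2 * (Real.pi / 2) :=
    norm_mul_le_of_le norm_sqStieltjesOp_le norm_sqStieltjesOp_le
  calc ‖hartleySqInvOp‖
      ≤ 1 / 2 * 1 + 1 / Real.pi ^ 2 * (Real.pi / 2 * (Real.pi / 2)) := by
        refine (norm_sub_le _ _).trans (add_le_add ?_ ?_)
        · rw [norm_smul]
          gcongr
          norm_num
        · rw [norm_smul]
          gcongr
          simp
    _ ≤ 1 := by
        field_simp
        norm_num

theorem coeFn_stieltjesOp (f : L2HalfLine) : stieltjesOp f =ᵐ[halfLine]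
    fun x => ∫ t in Ioi (0 : ℝ), f t / ((x + t : ℝ) : ℂ) := by
  filter_upwards [isSchurKernel_stieltjesKernel.coeFn_op f] with x hx
  rw [stieltjesOp, hx]
  simp only [stieltjesKernel, Complex.ofReal_div, Complex.ofReal_one, one_div_mul_eq_div]

theorem coeFn_hartleySqOp (f : L2HalfLine) : hartleySqOp f =ᵐ[halfLine] fun x =>
    2 * f x + (2 / Real.pi : ℂ) * ∫ t in Ioi (0 : ℝ), f t / ((x + t : ℝ) : ℂ) := by
  filter_upwards [Lp.coeFn_add ((2 : ℂ) • f) ((2 / Real.pi : ℂ) • stieltjesOp f),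
    Lp.coeFn_smul (2 : ℂ) f, Lp.coeFn_smul (2 / Real.pi : ℂ) (stieltjesOp f),
    coeFn_stieltjesOp f] with x hadd hsmul hsmul' hop
  exact hadd.trans (by rw [Pi.add_apply, hsmul, hsmul', Pi.smul_apply, Pi.smul_apply, hop,
    smul_eq_mul, smul_eq_mul])

theorem coeFn_hartleySqInvOp (g : L2HalfLine) : hartleySqInvOp g =ᵐ[halfLine] fun x =>
    (1 / 2 : ℂ) * g x -
      (1 / (Real.pi : ℂ) ^ 2) * ∫ t in Ioi (0 : ℝ), (logKernel x t : ℂ) * g t := by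
  filter_upwards [
    Lp.coeFn_sub ((1 / 2 : ℂ) • g) ((1 / Real.pi ^ 2 : ℂ) • sqStieltjesOp (sqStieltjesOp g)),
    Lp.coeFn_smul (1 / 2 : ℂ) g,
    Lp.coeFn_smul (1 / Real.pi ^ 2 : ℂ) (sqStieltjesOp (sqStieltjesOp g)),
    coeFn_sqStieltjesOp_sqStieltjesOp g] with x hsub hsmul hsmul' hop
  exact hsub.trans (by rw [Pi.sub_apply, hsmul, hsmul', Pi.smul_apply, Pi.smul_apply, hop,
    smul_eq_mul, smul_eq_mul])

theorem integrable_div_add {f : ℝ → ℂ} (hf : MemLp f 2 halfLine) {x : ℝ} (hx : 0 < x) :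
    Integrable (fun t => f t / ((x + t : ℝ) : ℂ)) halfLine := by
  refine ((memLp_stieltjesKernel hx).integrable_mul hf).congr (ae_of_all _ fun t => ?_)
  simp only [Pi.mul_apply, stieltjesKernel, Complex.ofReal_div, Complex.ofReal_one,
    one_div_mul_eq_div]

end Operators

section Cas

/-- Hartley's function `cas`, the sum of cosine and sine. -/
noncomputable def cas (θ : ℝ) : ℝ := Real.cos θ + Real.sin θ

theorem norm_ofReal_cas_le (θ : ℝ) : ‖(cas θ : ℂ)‖ ≤ 2 := by
  rw [Complex.norm_real, ← one_add_one_eq_two]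
  exact norm_add_le_of_le (Real.abs_cos_le_one θ) (Real.abs_sin_le_one θ)

theorem hasDerivAt_cas (θ : ℝ) : HasDerivAt cas (cas (-θ)) θ := by
  refine ((Real.hasDerivAt_cos θ).add (Real.hasDerivAt_sin θ)).congr_deriv ?_
  rw [cas, Real.cos_neg, Real.sin_neg, add_comm]

@[fun_prop]
theorem continuous_cas : Continuous cas := Real.continuous_cos.add Real.continuous_sin

theorem cas_mul_cas (α β : ℝ) : cas α * cas β = Real.cos (β - α) + Real.sin (β + α) := by
  rw [cas, cas, Real.cos_sub, Real.sin_add]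
  ring

variable {f f' f'' : ℝ → ℂ} {μ : Measure ℝ}

theorem integrable_cas_mul (hf : Integrable f μ) (x : ℝ) :
    Integrable (fun t => (cas (x * t) : ℂ) * f t) μ :=
  hf.bdd_mul (c := 2) (by fun_prop) (ae_of_all _ fun _ => norm_ofReal_cas_le _)

theorem norm_integral_cas_mul_le (hf : Integrable f μ) (x : ℝ) :
    ‖∫ t, (cas (x * t) : ℂ) * f t ∂μ‖ ≤ 2 * ∫ t, ‖f t‖ ∂μ := by
  rw [← integral_const_mul]
  refine norm_integral_le_of_norm_le (hf.norm.const_mul 2) (ae_of_all _ fun t => ?_)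
  rw [norm_mul]
  gcongr
  exact norm_ofReal_cas_le _

theorem integral_cas_mul_of_hasDerivAt (hderiv : ∀ t, HasDerivAt f (f' t) t) (hf : Integrable f)
    (hf' : Integrable f') (x : ℝ) :
    ∫ t, (cas (x * t) : ℂ) * f' t = -(x * ∫ t, (cas (-x * t) : ℂ) * f t) := by
  have hcas : ∀ t, HasDerivAt (fun t : ℝ => (cas (x * t) : ℂ)) (x * (cas (-x * t) : ℂ)) t :=
    fun t => by
      have h := ((hasDerivAt_cas (x * t)).comp t ((hasDerivAt_id t).const_mul x)).ofReal_comp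
      exact h.congr_deriv (by push_cast; ring_nf)
  have hint : Integrable fun t => (x * (cas (-x * t) : ℂ)) * f t := by
    simpa only [mul_assoc] using (integrable_cas_mul hf (-x)).const_mul (x : ℂ)
  rw [integral_mul_deriv_eq_deriv_mul_of_integrable (fun t _ => hcas t) (fun t _ => hderiv t)
    (integrable_cas_mul hf' x) hint (integrable_cas_mul hf x)]
  simp only [mul_assoc, integral_const_mul]

theorem sq_mul_integral_cas_mul (hderiv : ∀ t, HasDerivAt f (f' t) t)
    (hderiv' : ∀ t, HasDerivAt f' (f'' t) t) (hf : Integrable f) (hf' : Integrable f')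
    (hf'' : Integrable f'') (x : ℝ) :
    (x : ℂ) ^ 2 * ∫ t, (cas (x * t) : ℂ) * f t = -∫ t, (cas (x * t) : ℂ) * f'' t := by
  rw [integral_cas_mul_of_hasDerivAt hderiv' hf' hf'',
    integral_cas_mul_of_hasDerivAt hderiv hf hf', neg_neg x]
  push_cast
  ring

theorem norm_integral_cas_mul_le_mul_inv_one_add_sq (hderiv : ∀ t, HasDerivAt f (f' t) t)
    (hderiv' : ∀ t, HasDerivAt f' (f'' t) t) (hf : Integrable f) (hf' : Integrable f')
    (hf'' : Integrable f'') (x : ℝ) :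
    ‖∫ t, (cas (x * t) : ℂ) * f t‖ ≤
      (2 * (∫ t, ‖f t‖) + 2 * ∫ t, ‖f'' t‖) * (1 + x ^ 2)⁻¹ := by
  have hsq : x ^ 2 * ‖∫ t, (cas (x * t) : ℂ) * f t‖ ≤ 2 * ∫ t, ‖f'' t‖ := by
    have h := norm_integral_cas_mul_le hf'' x
    rwa [← norm_neg, ← sq_mul_integral_cas_mul hderiv hderiv' hf hf' hf'', norm_mul, norm_pow,
      Complex.norm_real, Real.norm_eq_abs, sq_abs] at h
  rw [← div_eq_mul_inv, le_div_iff₀ (by positivity)]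
  linarith [norm_integral_cas_mul_le hf x]

end Cas

section HalfHartley

variable {f g : ℝ → ℂ}

theorem halfHartley_eq (f : ℝ → ℂ) (x : ℝ) :
    halfHartley f x = (√(2 / Real.pi) : ℂ) * ∫ t, (cas (x * t) : ℂ) * f t ∂halfLine := rfl

theorem sqrt_two_div_pi_mul_self : (√(2 / Real.pi) : ℂ) * (√(2 / Real.pi) : ℂ) = 2 / Real.pi := by
  rw [← Complex.ofReal_mul, Real.mul_self_sqrt (by positivity), Complex.ofReal_div,
    Complex.ofReal_ofNat]

theorem aestronglyMeasurable_halfHartley (hf : AEStronglyMeasurable f halfLine) :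
    AEStronglyMeasurable (halfHartley f) halfLine := by
  have hcas : Continuous fun z : ℝ × ℝ => (cas (z.1 * z.2) : ℂ) := by fun_prop
  exact (hcas.aestronglyMeasurable.mul hf.comp_snd).integral_prod_right'.const_mul _

theorem norm_halfHartley_le (hf : Integrable f halfLine) (x : ℝ) :
    ‖halfHartley f x‖ ≤ √(2 / Real.pi) * (2 * ∫ t, ‖f t‖ ∂halfLine) := by
  rw [halfHartley_eq, norm_mul, Complex.norm_real, Real.norm_of_nonneg (Real.sqrt_nonneg _)]
  gcongr
  exact norm_integral_cas_mul_le hf x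

theorem memLp_halfHartley (hf : Integrable f halfLine)
    (hHf : Integrable (halfHartley f) halfLine) : MemLp (halfHartley f) 2 halfLine := by
  rw [memLp_two_iff_integrable_sq_norm hHf.1]
  simp only [sq]
  refine hHf.norm.bdd_mul (c := √(2 / Real.pi) * (2 * ∫ t, ‖f t‖ ∂halfLine)) hHf.1.norm
    (ae_of_all _ fun x => ?_)
  rw [norm_norm]
  exact norm_halfHartley_le hf x

theorem halfHartley_add (hf : Integrable f halfLine) (hg : Integrable g halfLine) :
    halfHartley (f + g) = halfHartley f + halfHartley g := by
  ext x
  simp only [halfHartley_eq, Pi.add_apply, mul_add]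
  rw [integral_add (integrable_cas_mul hf x) (integrable_cas_mul hg x), mul_add]

theorem halfHartley_smul (c : ℂ) (f : ℝ → ℂ) : halfHartley (c • f) = c • halfHartley f := by
  ext x
  simp only [halfHartley_eq, Pi.smul_apply, smul_eq_mul, mul_left_comm _ c, integral_const_mul]

theorem halfHartley_conj (f : ℝ → ℂ) (x : ℝ) :
    halfHartley (fun t => conj (f t)) x = conj (halfHartley f x) := by
  simp only [halfHartley_eq, map_mul, Complex.conj_ofReal, ← integral_conj]

theorem integral_halfHartley_mul (hf : Integrable f halfLine) (hg : Integrable g halfLine) :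
    ∫ x, halfHartley f x * g x ∂halfLine = ∫ x, f x * halfHartley g x ∂halfLine := by
  have hint : Integrable (fun z : ℝ × ℝ => (cas (z.1 * z.2) : ℂ) * (g z.1 * f z.2))
      (halfLine.prod halfLine) :=
    (hg.mul_prod hf).bdd_mul (c := 2) (by fun_prop) (ae_of_all _ fun _ => norm_ofReal_cas_le _)
  calc ∫ x, halfHartley f x * g x ∂halfLine
      = √(2 / Real.pi) * ∫ x, ∫ t, (cas (x * t) : ℂ) * (g x * f t) ∂halfLine ∂halfLine := by
        simp only [halfHartley_eq, mul_assoc, integral_const_mul, ← integral_mul_const,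
          mul_comm (f _)]
    _ = √(2 / Real.pi) * ∫ t, ∫ x, (cas (x * t) : ℂ) * (g x * f t) ∂halfLine ∂halfLine := by
        rw [integral_integral_swap hint]
    _ = ∫ x, f x * halfHartley g x ∂halfLine := by
        rw [← integral_const_mul]
        refine integral_congr_ae (ae_of_all _ fun t => ?_)
        simp only [halfHartley_eq, ← integral_const_mul]
        refine integral_congr_ae (ae_of_all _ fun x => ?_)
        simp only [mul_comm t x]
        ring

end HalfHartley

section Abel

/-- The Poisson kernel of the upper half-plane at height `ε`, without the factor `1 / π`. -/
noncomputable def halfPlanePoisson (ε u : ℝ) : ℝ := ε / (ε ^ 2 + u ^ 2)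

/-- The conjugate Poisson kernel of the upper half-plane at height `ε`, without the factor
`1 / π`. -/
noncomputable def halfPlaneConjPoisson (ε u : ℝ) : ℝ := u / (ε ^ 2 + u ^ 2)

theorem measurable_halfPlanePoisson (ε : ℝ) : Measurable (halfPlanePoisson ε) := by
  unfold halfPlanePoisson
  fun_prop

theorem measurable_halfPlaneConjPoisson (ε : ℝ) : Measurable (halfPlaneConjPoisson ε) := by
  unfold halfPlaneConjPoisson
  fun_prop

theorem abs_div_sq_add_sq_le (a b : ℝ) : |a / (a ^ 2 + b ^ 2)| ≤ |a|⁻¹ := by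
  rcases eq_or_ne a 0 with rfl | ha
  · simp
  have habs : 0 < |a| := abs_pos.2 ha
  rw [abs_div, abs_of_pos (by positivity : 0 < a ^ 2 + b ^ 2), ← sq_abs a, inv_eq_one_div,
    div_le_div_iff₀ (by positivity) habs]
  linarith [sq_nonneg b]

theorem abs_halfPlanePoisson_le (ε u : ℝ) : |halfPlanePoisson ε u| ≤ |ε|⁻¹ :=
  abs_div_sq_add_sq_le ε u

theorem abs_halfPlaneConjPoisson_le (ε u : ℝ) : |halfPlaneConjPoisson ε u| ≤ |u|⁻¹ := by
  rw [halfPlaneConjPoisson, add_comm]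
  exact abs_div_sq_add_sq_le u ε

theorem re_exp_mul_ofReal (ε a y : ℝ) :
    (Complex.exp (⟨-ε, a⟩ * y)).re = Real.exp (-ε * y) * Real.cos (a * y) := by
  simp [Complex.exp_re]

theorem im_exp_mul_ofReal (ε a y : ℝ) :
    (Complex.exp (⟨-ε, a⟩ * y)).im = Real.exp (-ε * y) * Real.sin (a * y) := by
  simp [Complex.exp_im]

variable {ε : ℝ}

theorem integrable_exp_mul_complex_halfLine (hε : 0 < ε) (a : ℝ) :
    Integrable (fun y : ℝ => Complex.exp (⟨-ε, a⟩ * y)) halfLine :=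
  integrableOn_exp_mul_complex_Ioi (a := ⟨-ε, a⟩) (neg_lt_zero.2 hε) 0

theorem integral_exp_mul_complex_halfLine (hε : 0 < ε) (a : ℝ) :
    ∫ y : ℝ, Complex.exp (⟨-ε, a⟩ * y) ∂halfLine =
      ⟨halfPlanePoisson ε a, halfPlaneConjPoisson ε a⟩ := by
  rw [integral_exp_mul_complex_Ioi (a := ⟨-ε, a⟩) (neg_lt_zero.2 hε), halfPlanePoisson,
    halfPlaneConjPoisson]
  apply Complex.ext <;>
    simp [Complex.div_re, Complex.div_im, Complex.normSq_apply] <;> ring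

theorem integrable_exp_mul_cos (hε : 0 < ε) (a : ℝ) :
    Integrable (fun y => Real.exp (-ε * y) * Real.cos (a * y)) halfLine := by
  simpa only [RCLike.re_to_complex, re_exp_mul_ofReal] using
    (integrable_exp_mul_complex_halfLine hε a).re

theorem integrable_exp_mul_sin (hε : 0 < ε) (a : ℝ) :
    Integrable (fun y => Real.exp (-ε * y) * Real.sin (a * y)) halfLine := by
  simpa only [RCLike.im_to_complex, im_exp_mul_ofReal] using
    (integrable_exp_mul_complex_halfLine hε a).im

theorem integral_exp_mul_cos (hε : 0 < ε) (a : ℝ) :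
    ∫ y, Real.exp (-ε * y) * Real.cos (a * y) ∂halfLine = halfPlanePoisson ε a := by
  simpa only [RCLike.re_to_complex, re_exp_mul_ofReal, integral_exp_mul_complex_halfLine hε] using
    integral_re (integrable_exp_mul_complex_halfLine hε a)

theorem integral_exp_mul_sin (hε : 0 < ε) (a : ℝ) :
    ∫ y, Real.exp (-ε * y) * Real.sin (a * y) ∂halfLine = halfPlaneConjPoisson ε a := by
  simpa only [RCLike.im_to_complex, im_exp_mul_ofReal, integral_exp_mul_complex_halfLine hε] using
    integral_im (integrable_exp_mul_complex_halfLine hε a)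

theorem integrable_exp_mul_cas (hε : 0 < ε) (x : ℝ) :
    Integrable (fun y => ((Real.exp (-ε * y) * cas (x * y) : ℝ) : ℂ)) halfLine := by
  simp only [cas, mul_add]
  exact ((integrable_exp_mul_cos hε x).fun_add (integrable_exp_mul_sin hε x)).ofReal

theorem halfHartley_exp_mul_cas (hε : 0 < ε) (x t : ℝ) :
    halfHartley (fun y => ((Real.exp (-ε * y) * cas (x * y) : ℝ) : ℂ)) t =
      √(2 / Real.pi) * ((halfPlanePoisson ε (x - t) + halfPlaneConjPoisson ε (x + t) : ℝ) : ℂ) := by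
  rw [halfHartley_eq, ← integral_exp_mul_cos hε, ← integral_exp_mul_sin hε,
    ← integral_add (integrable_exp_mul_cos hε _) (integrable_exp_mul_sin hε _),
    ← integral_complex_ofReal]
  simp only [← Complex.ofReal_mul, mul_left_comm (cas _), cas_mul_cas, mul_add, sub_mul, add_mul]

variable {f : ℝ → ℂ} {x : ℝ}

theorem tendsto_integral_exp_mul (hf : Integrable f halfLine) :
    Tendsto (fun ε : ℝ => ∫ y, (Real.exp (-ε * y) : ℂ) * f y ∂halfLine) (𝓝[>] 0)
      (𝓝 (∫ y, f y ∂halfLine)) := by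
  refine tendsto_integral_filter_of_dominated_convergence (fun y => ‖f y‖)
    (Eventually.of_forall fun ε => ?_) ?_ hf.norm (ae_of_all _ fun y => ?_)
  · exact AEStronglyMeasurable.mul (by fun_prop) hf.1
  · filter_upwards [self_mem_nhdsWithin] with ε (hε : 0 < ε)
    filter_upwards [ae_halfLine_pos] with y hy
    rw [norm_mul, Complex.norm_real, Real.norm_of_nonneg (Real.exp_pos _).le]
    refine mul_le_of_le_one_left (norm_nonneg _) (Real.exp_le_one_iff.2 ?_)
    exact mul_nonpos_of_nonpos_of_nonneg (neg_nonpos.2 hε.le) hy.le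
  · have hcont : Continuous fun ε : ℝ => (Real.exp (-ε * y) : ℂ) * f y := by fun_prop
    simpa using (hcont.tendsto 0).mono_left nhdsWithin_le_nhds

theorem integrable_halfPlanePoisson_mul (hf : Integrable f halfLine) (ε x : ℝ) :
    Integrable (fun t => (halfPlanePoisson ε (x - t) : ℂ) * f t) halfLine :=
  hf.bdd_mul (c := |ε|⁻¹) (Complex.measurable_ofReal.comp
    ((measurable_halfPlanePoisson ε).comp (by fun_prop))).aestronglyMeasurable
    (ae_of_all _ fun t => by
      rw [Complex.norm_real]
      exact abs_halfPlanePoisson_le ε (x - t))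

theorem norm_halfPlaneConjPoisson_le (hx : 0 < x) (ε : ℝ) :
    ∀ᵐ t ∂halfLine, ‖(halfPlaneConjPoisson ε (x + t) : ℂ)‖ ≤ x⁻¹ := by
  filter_upwards [ae_halfLine_pos] with t ht
  rw [Complex.norm_real]
  refine (abs_halfPlaneConjPoisson_le ε (x + t)).trans (inv_anti₀ hx ?_)
  exact (le_add_of_nonneg_right ht.le).trans (le_abs_self _)

theorem integrable_halfPlaneConjPoisson_mul (hf : Integrable f halfLine) (hx : 0 < x) (ε : ℝ) :
    Integrable (fun t => (halfPlaneConjPoisson ε (x + t) : ℂ) * f t) halfLine :=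
  hf.bdd_mul (Complex.measurable_ofReal.comp
    ((measurable_halfPlaneConjPoisson ε).comp (by fun_prop))).aestronglyMeasurable
    (norm_halfPlaneConjPoisson_le hx ε)

theorem integral_halfPlanePoisson_one : ∫ u, Real.pi⁻¹ * halfPlanePoisson 1 u = 1 := by
  simp only [halfPlanePoisson, one_pow, one_div]
  rw [integral_const_mul, integral_univ_inv_one_add_sq, inv_mul_cancel₀ Real.pi_ne_zero]

theorem tendsto_norm_mul_halfPlanePoisson_one :
    Tendsto (fun u : ℝ => ‖u‖ ^ Module.finrank ℝ ℝ * (Real.pi⁻¹ * halfPlanePoisson 1 u))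
      (Bornology.cobounded ℝ) (𝓝 0) := by
  have hzero : Tendsto (fun u : ℝ => Real.pi⁻¹ * ‖u‖⁻¹) (Bornology.cobounded ℝ) (𝓝 0) := by
    simpa using (tendsto_norm_cobounded_atTop (E := ℝ)).inv_tendsto_atTop.const_mul Real.pi⁻¹
  refine squeeze_zero (fun u => ?_) (fun u => ?_) hzero
  · unfold halfPlanePoisson
    positivity
  · have h := abs_halfPlaneConjPoisson_le 1 u
    rw [halfPlaneConjPoisson, abs_div, abs_of_pos (by positivity : 0 < (1 : ℝ) ^ 2 + u ^ 2)] at h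
    rw [Module.finrank_self, pow_one, mul_left_comm, halfPlanePoisson, mul_one_div]
    gcongr
    exact h

theorem tendsto_integral_halfPlanePoisson_mul (hf : Integrable f halfLine) (hx : 0 < x)
    (hcont : ContinuousAt f x) :
    Tendsto (fun ε => ∫ t, (halfPlanePoisson ε (x - t) : ℂ) * f t ∂halfLine) (𝓝[>] 0)
      (𝓝 (Real.pi * f x)) := by
  have heq : (Ioi 0).indicator f =ᶠ[𝓝 x] f :=
    eqOn_indicator.eventuallyEq_of_mem (Ioi_mem_nhds hx)
  have hnonneg : ∀ u, 0 ≤ Real.pi⁻¹ * halfPlanePoisson 1 u := fun u => by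
    unfold halfPlanePoisson
    positivity
  have hpeak := ((tendsto_integral_comp_smul_smul_of_integrable' hnonneg
    integral_halfPlanePoisson_one tendsto_norm_mul_halfPlanePoisson_one
    ((integrable_indicator_iff measurableSet_Ioi).2 hf) (hcont.congr heq.symm)).comp
      tendsto_inv_nhdsGT_zero).const_mul (Real.pi : ℂ)
  rw [heq.eq_of_nhds] at hpeak
  refine hpeak.congr' ?_
  filter_upwards [self_mem_nhdsWithin] with ε (hε : 0 < ε)
  have hscale : ∀ u, Real.pi * (ε⁻¹ * (Real.pi⁻¹ * halfPlanePoisson 1 (ε⁻¹ * u))) =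
      halfPlanePoisson ε u := fun u => by
    unfold halfPlanePoisson
    field_simp
  rw [Function.comp_apply, ← integral_const_mul, ← integral_indicator measurableSet_Ioi]
  refine integral_congr_ae (ae_of_all _ fun t => ?_)
  by_cases ht : t ∈ Ioi (0 : ℝ)
  · simp only [indicator_of_mem ht, ← hscale, Module.finrank_self, pow_one, Complex.real_smul,
      Complex.ofReal_mul, mul_assoc, smul_eq_mul]
  · simp only [indicator_of_notMem ht, smul_zero, mul_zero]

theorem tendsto_integral_halfPlaneConjPoisson_mul (hf : Integrable f halfLine) (hx : 0 < x) :
    Tendsto (fun ε => ∫ t, (halfPlaneConjPoisson ε (x + t) : ℂ) * f t ∂halfLine) (𝓝[>] 0)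
      (𝓝 (∫ t, f t / ((x + t : ℝ) : ℂ) ∂halfLine)) := by
  refine tendsto_integral_filter_of_dominated_convergence (fun t => x⁻¹ * ‖f t‖)
    (Eventually.of_forall fun ε => (integrable_halfPlaneConjPoisson_mul hf hx ε).1)
    (Eventually.of_forall fun ε => ?_) (hf.norm.const_mul _) ?_
  · filter_upwards [norm_halfPlaneConjPoisson_le hx ε] with t ht
    rw [norm_mul]
    gcongr
  · filter_upwards [ae_halfLine_pos] with t ht
    have hcont : ContinuousAt (fun ε => (halfPlaneConjPoisson ε (x + t) : ℂ) * f t) 0 := by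
      unfold halfPlaneConjPoisson
      fun_prop (disch := positivity)
    have hzero : (halfPlaneConjPoisson 0 (x + t) : ℂ) * f t = f t / ((x + t : ℝ) : ℂ) := by
      rw [halfPlaneConjPoisson, zero_pow two_ne_zero, zero_add, sq, div_self_mul_self',
        Complex.ofReal_inv, inv_mul_eq_div]
    rw [← hzero]
    exact hcont.tendsto.mono_left nhdsWithin_le_nhds

theorem integral_exp_mul_cas_mul_halfHartley (hε : 0 < ε) (hf : Integrable f halfLine)
    (hx : 0 < x) :
    √(2 / Real.pi) * ∫ y, ((Real.exp (-ε * y) * cas (x * y) : ℝ) : ℂ) * halfHartley f y ∂halfLine =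
      2 / Real.pi * ((∫ t, (halfPlanePoisson ε (x - t) : ℂ) * f t ∂halfLine) +
        ∫ t, (halfPlaneConjPoisson ε (x + t) : ℂ) * f t ∂halfLine) := by
  rw [← integral_halfHartley_mul (integrable_exp_mul_cas hε x) hf,
    ← integral_add (integrable_halfPlanePoisson_mul hf ε x)
      (integrable_halfPlaneConjPoisson_mul hf hx ε), ← sqrt_two_div_pi_mul_self]
  simp only [halfHartley_exp_mul_cas hε, mul_assoc, integral_const_mul, Complex.ofReal_add,
    add_mul]

theorem halfHartley_halfHartley_apply (hf : Integrable f halfLine)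
    (hHf : Integrable (halfHartley f) halfLine) (hx : 0 < x) (hcont : ContinuousAt f x) :
    halfHartley (halfHartley f) x =
      2 * f x + (2 / Real.pi : ℂ) * ∫ t in Ioi (0 : ℝ), f t / ((x + t : ℝ) : ℂ) := by
  have habel : Tendsto (fun ε : ℝ => √(2 / Real.pi) *
      ∫ y, ((Real.exp (-ε * y) * cas (x * y) : ℝ) : ℂ) * halfHartley f y ∂halfLine)
      (𝓝[>] 0) (𝓝 (halfHartley (halfHartley f) x)) := by
    rw [halfHartley_eq (halfHartley f)]
    simpa only [Complex.ofReal_mul, mul_assoc] using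
      (tendsto_integral_exp_mul (integrable_cas_mul hHf x)).const_mul (√(2 / Real.pi) : ℂ)
  have hlim := ((tendsto_integral_halfPlanePoisson_mul hf hx hcont).add
    (tendsto_integral_halfPlaneConjPoisson_mul hf hx)).const_mul (2 / Real.pi : ℂ)
  rw [mul_add, ← mul_assoc, div_mul_cancel₀ _ (Complex.ofReal_ne_zero.2 Real.pi_ne_zero)] at hlim
  refine tendsto_nhds_unique habel (hlim.congr' ?_)
  filter_upwards [self_mem_nhdsWithin] with ε hε
  exact (integral_exp_mul_cas_mul_halfHartley hε hf hx).symm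

end Abel

section SelfAdjoint

theorem mul_eq_one_symm_of_isSelfAdjoint {R : Type*} [Monoid R] [StarMul R] {a b : R}
    (ha : IsSelfAdjoint a) (h : a * b = 1) : b * a = 1 := by
  have hstar : star b * a = 1 := by
    simpa only [star_mul, ha.star_eq, star_one] using congrArg star h
  rw [← left_inv_eq_right_inv hstar h, hstar]

variable {𝕜 E : Type*} [RCLike 𝕜] [NormedAddCommGroup E] [InnerProductSpace 𝕜 E]

theorem norm_le_sqrt_mul_norm_of_inner_self_eq (T : E →L[𝕜] E) {x y : E}
    (h : inner 𝕜 x x = inner 𝕜 y (T y)) : ‖x‖ ≤ √‖T‖ * ‖y‖ := by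
  refine le_of_sq_le_sq ?_ (by positivity)
  calc ‖x‖ ^ 2 = RCLike.re (inner 𝕜 y (T y)) := by rw [← h, inner_self_eq_norm_sq]
    _ ≤ ‖y‖ * ‖T y‖ := re_inner_le_norm _ _
    _ ≤ ‖y‖ * (‖T‖ * ‖y‖) := by
        gcongr
        exact T.le_opNorm y
    _ = (√‖T‖ * ‖y‖) ^ 2 := by
        rw [mul_pow, Real.sq_sqrt (norm_nonneg T)]
        ring

variable {V : Type*} [AddCommGroup V] [Module 𝕜 V]

theorem exists_isSelfAdjoint_extension_mul_self_eq [CompleteSpace E] {ι A : V →ₗ[𝕜] E}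
    {T : E →L[𝕜] E} (hι : DenseRange ι)
    (hsymm : ∀ v w, inner 𝕜 (A v) (ι w) = inner 𝕜 (ι v) (A w))
    (hsq : ∀ v w, inner 𝕜 (A v) (A w) = inner 𝕜 (ι v) (T (ι w))) :
    ∃ H : E →L[𝕜] E, IsSelfAdjoint H ∧ H * H = T ∧ ∀ v, H (ι v) = A v := by
  let H : E →L[𝕜] E := A.extendOfNorm ι
  have hext : ∀ v, H (ι v) = A v :=
    LinearMap.extendOfNorm_eq hι ⟨√‖T‖, fun v =>
      norm_le_sqrt_mul_norm_of_inner_self_eq T (hsq v v)⟩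
  have hself : ∀ x y, inner 𝕜 (H x) y = inner 𝕜 x (H y) := fun x y =>
    hι.induction_on₂ (p := fun x y => inner 𝕜 (H x) y = inner 𝕜 x (H y))
      (isClosed_eq (by fun_prop) (by fun_prop))
      (fun v w => by rw [hext, hext, hsymm]) x y
  have hmul : ∀ x y, inner 𝕜 x (H (H y)) = inner 𝕜 x (T y) := fun x y =>
    hι.induction_on₂ (p := fun x y => inner 𝕜 x (H (H y)) = inner 𝕜 x (T y))
      (isClosed_eq (by fun_prop) (by fun_prop))
      (fun v w => by rw [← hself, hext, hext, hsq]) x y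
  exact ⟨H, ContinuousLinearMap.isSelfAdjoint_iff_isSymmetric.2 hself,
    ContinuousLinearMap.ext fun y => ext_inner_left 𝕜 fun x => hmul x y, hext⟩

end SelfAdjoint

section TestFunctions

namespace IsTestFunction

variable {f : ℝ → ℂ}

theorem integrable_volume (hf : IsTestFunction f) : Integrable f :=
  hf.contDiff.continuous.integrable_of_hasCompactSupport hf.hasCompactSupport

theorem integrable (hf : IsTestFunction f) : Integrable f halfLine :=
  hf.integrable_volume.restrict

theorem memLp (hf : IsTestFunction f) : MemLp f 2 halfLine :=
  (hf.contDiff.continuous.memLp_of_hasCompactSupport hf.hasCompactSupport).restrict _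

theorem setIntegral_mul (hf : IsTestFunction f) (g : ℝ → ℂ) :
    ∫ t, g t * f t ∂halfLine = ∫ t, g t * f t :=
  setIntegral_eq_integral_of_forall_compl_eq_zero fun t ht => by
    rw [image_eq_zero_of_notMem_tsupport fun h => ht (hf.tsupport_subset h), mul_zero]

theorem conj_comp (hf : IsTestFunction f) : IsTestFunction fun t => conj (f t) where
  contDiff := Complex.conjCLE.contDiff.comp hf.contDiff
  hasCompactSupport := hf.hasCompactSupport.comp_left (map_zero _)
  tsupport_subset := (tsupport_comp_subset (map_zero _) f).trans hf.tsupport_subset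

theorem contDiff_deriv (hf : IsTestFunction f) : ContDiff ℝ 1 (deriv f) := by
  have h := hf.contDiff
  rw [← one_add_one_eq_two, contDiff_succ_iff_deriv] at h
  exact h.2.2

theorem norm_integral_cas_mul_le_mul_inv_one_add_sq (hf : IsTestFunction f) (x : ℝ) :
    ‖∫ t, (cas (x * t) : ℂ) * f t‖ ≤
      (2 * (∫ t, ‖f t‖) + 2 * ∫ t, ‖deriv (deriv f) t‖) * (1 + x ^ 2)⁻¹ :=
  _root_.norm_integral_cas_mul_le_mul_inv_one_add_sq
    (fun t => (hf.contDiff.differentiable two_ne_zero t).hasDerivAt)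
    (fun t => (hf.contDiff_deriv.differentiable one_ne_zero t).hasDerivAt) hf.integrable_volume
    (hf.contDiff_deriv.continuous.integrable_of_hasCompactSupport hf.hasCompactSupport.deriv)
    ((hf.contDiff_deriv.continuous_deriv le_rfl).integrable_of_hasCompactSupport
      hf.hasCompactSupport.deriv.deriv) x

theorem integrable_halfHartley (hf : IsTestFunction f) : Integrable (halfHartley f) halfLine := by
  let M : ℝ := 2 * (∫ t, ‖f t‖) + 2 * ∫ t, ‖deriv (deriv f) t‖
  refine Integrable.mono' ((integrable_inv_one_add_sq.const_mul M).const_mul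
    √(2 / Real.pi)).restrict (aestronglyMeasurable_halfHartley hf.integrable.1)
    (ae_of_all _ fun x => ?_)
  rw [halfHartley_eq, hf.setIntegral_mul, norm_mul, Complex.norm_real,
    Real.norm_of_nonneg (Real.sqrt_nonneg _)]
  gcongr
  exact hf.norm_integral_cas_mul_le_mul_inv_one_add_sq x

theorem memLp_halfHartley (hf : IsTestFunction f) : MemLp (halfHartley f) 2 halfLine :=
  _root_.memLp_halfHartley hf.integrable hf.integrable_halfHartley

end IsTestFunction

/-- The space `C_c^(2)(ℝ₊)` of test functions. -/
def testSpace : Submodule ℂ (ℝ → ℂ) where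
  carrier := {f | IsTestFunction f}
  add_mem' {f g} hf hg :=
    ⟨hf.contDiff.add hg.contDiff, hf.hasCompactSupport.add hg.hasCompactSupport,
      (tsupport_add f g).trans (union_subset hf.tsupport_subset hg.tsupport_subset)⟩
  zero_mem' := ⟨contDiff_const, HasCompactSupport.zero, by simp [tsupport]⟩
  smul_mem' c f hf :=
    ⟨contDiff_const.smul hf.contDiff, hf.hasCompactSupport.smul_left,
      (tsupport_smul_subset_right (fun _ => c) f).trans hf.tsupport_subset⟩

/-- The inclusion of the test functions in `L₂(ℝ₊)`. -/
noncomputable def testIncl : testSpace →ₗ[ℂ] L2HalfLine where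
  toFun f := (IsTestFunction.memLp f.2).toLp f
  map_add' _ _ := rfl
  map_smul' _ _ := rfl

/-- The half-Hartley transform as a linear map from the test functions to `L₂(ℝ₊)`. -/
noncomputable def testHartley : testSpace →ₗ[ℂ] L2HalfLine where
  toFun f := (IsTestFunction.memLp_halfHartley f.2).toLp _
  map_add' f g := by
    rw [← MemLp.toLp_add, MemLp.toLp_eq_toLp_iff]
    exact Eventually.of_forall (congrFun (halfHartley_add (IsTestFunction.integrable f.2)
      (IsTestFunction.integrable g.2)))
  map_smul' c f := by
    rw [← MemLp.toLp_const_smul, MemLp.toLp_eq_toLp_iff]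
    exact Eventually.of_forall (congrFun (halfHartley_smul c f))

theorem coeFn_testIncl (f : testSpace) : testIncl f =ᵐ[halfLine] (f : ℝ → ℂ) :=
  MemLp.coeFn_toLp (IsTestFunction.memLp f.2)

theorem coeFn_testHartley (f : testSpace) : testHartley f =ᵐ[halfLine] halfHartley f :=
  MemLp.coeFn_toLp (IsTestFunction.memLp_halfHartley f.2)

theorem isTestFunction_ofReal {φ : ℝ → ℝ} (hφ : ContDiff ℝ 2 φ) (hcompact : HasCompactSupport φ)
    (hsub : tsupport φ ⊆ Ioi 0) : IsTestFunction fun t => (φ t : ℂ) where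
  contDiff := Complex.ofRealCLM.contDiff.comp hφ
  hasCompactSupport := hcompact.comp_left Complex.ofReal_zero
  tsupport_subset := (tsupport_comp_subset Complex.ofReal_zero φ).trans hsub

theorem denseRange_testIncl : DenseRange testIncl := by
  suffices h : (LinearMap.range testIncl)ᗮ = ⊥ by
    rwa [DenseRange, ← LinearMap.coe_range, Submodule.dense_iff_topologicalClosure_eq_top,
      Submodule.topologicalClosure_eq_top_iff]
  refine (Submodule.eq_bot_iff _).2 fun g hg => ?_
  have hloc : LocallyIntegrable g halfLine := (Lp.memLp g).locallyIntegrable one_le_two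
  have hzero := isOpen_Ioi.ae_eq_zero_of_integral_contDiff_smul_eq_zero
    (hloc.locallyIntegrableOn (Ioi 0)) fun φ hφ hcompact hsub => by
      let ψ : testSpace := ⟨_, isTestFunction_ofReal (contDiff_infty.1 hφ 2) hcompact hsub⟩
      rw [← (Submodule.mem_orthogonal _ g).1 hg _ ⟨ψ, rfl⟩, L2.inner_def]
      refine integral_congr_ae ?_
      filter_upwards [coeFn_testIncl ψ] with t ht
      rw [ht, RCLike.inner_apply, Complex.conj_ofReal, mul_comm, Complex.real_smul]
  refine Lp.eq_zero_iff_ae_eq_zero.2 ?_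
  filter_upwards [hzero, ae_halfLine_pos] with t h ht using h ht

theorem extendsTransform_iff {K : (ℝ → ℂ) → ℝ → ℂ} {T : L2HalfLine →L[ℂ] L2HalfLine} :
    ExtendsTransform K T ↔ ∀ f : testSpace, T (testIncl f) =ᵐ[halfLine] K f :=
  ⟨fun h f => (h f.1 f.2).2, fun h f hf => ⟨hf.memLp, h ⟨f, hf⟩⟩⟩

theorem ExtendsTransform.unique {K : (ℝ → ℂ) → ℝ → ℂ} {T T' : L2HalfLine →L[ℂ] L2HalfLine}
    (h : ExtendsTransform K T) (h' : ExtendsTransform K T') : T = T' := by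
  rw [extendsTransform_iff] at h h'
  exact DFunLike.coe_injective (denseRange_testIncl.equalizer T.continuous T'.continuous
    (funext fun f => Lp.ext ((h f).trans (h' f).symm)))

theorem hartleySqOp_testIncl (f : testSpace) :
    hartleySqOp (testIncl f) =ᵐ[halfLine] halfHartley (halfHartley f) := by
  have hf : IsTestFunction f := f.2
  filter_upwards [coeFn_hartleySqOp (testIncl f), coeFn_testIncl f, ae_halfLine_pos] with x hT hι hx
  rw [hT, hι, halfHartley_halfHartley_apply hf.integrable hf.integrable_halfHartley hx
    hf.contDiff.continuous.continuousAt]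
  congr 2
  refine integral_congr_ae ?_
  filter_upwards [coeFn_testIncl f] with t ht
  rw [ht]

theorem extendsTransform_hartleySqOp :
    ExtendsTransform (fun f => halfHartley (halfHartley f)) hartleySqOp :=
  extendsTransform_iff.2 hartleySqOp_testIncl

theorem inner_eq_of_coeFn_eq_halfHartley (f : testSpace) {g : ℝ → ℂ} (hg : Integrable g halfLine)
    {u v : L2HalfLine} (hu : u =ᵐ[halfLine] g) (hv : v =ᵐ[halfLine] halfHartley g) :
    ⟪testHartley f, u⟫_ℂ = ⟪testIncl f, v⟫_ℂ := by
  have hf : IsTestFunction f := f.2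
  rw [L2.inner_def, L2.inner_def]
  calc ∫ x, ⟪testHartley f x, u x⟫_ℂ ∂halfLine
      = ∫ x, halfHartley (fun t => conj (f.1 t)) x * g x ∂halfLine := by
        refine integral_congr_ae ?_
        filter_upwards [coeFn_testHartley f, hu] with x hfx hux
        rw [hfx, hux, halfHartley_conj, RCLike.inner_apply, mul_comm]
    _ = ∫ x, conj (f.1 x) * halfHartley g x ∂halfLine :=
        integral_halfHartley_mul hf.conj_comp.integrable hg
    _ = ∫ x, ⟪testIncl f x, v x⟫_ℂ ∂halfLine := by
        refine integral_congr_ae ?_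
        filter_upwards [coeFn_testIncl f, hv] with x hfx hvx
        rw [hfx, hvx, RCLike.inner_apply, mul_comm]

theorem exists_isSelfAdjoint_extendsTransform_halfHartley :
    ∃ H : L2HalfLine →L[ℂ] L2HalfLine,
      IsSelfAdjoint H ∧ H * H = hartleySqOp ∧ ExtendsTransform halfHartley H := by
  obtain ⟨H, hself, hmul, hext⟩ := exists_isSelfAdjoint_extension_mul_self_eq
    (A := testHartley) (T := hartleySqOp) denseRange_testIncl
    (fun f g => inner_eq_of_coeFn_eq_halfHartley f (IsTestFunction.integrable g.2)
      (coeFn_testIncl g) (coeFn_testHartley g))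
    (fun f g => inner_eq_of_coeFn_eq_halfHartley f (IsTestFunction.integrable_halfHartley g.2)
      (coeFn_testHartley g) (hartleySqOp_testIncl g))
  refine ⟨H, hself, hmul, extendsTransform_iff.2 fun f => ?_⟩
  rw [hext]
  exact coeFn_testHartley f

end TestFunctions

section Inversion

theorem isSelfAdjoint_hartleySqOp : IsSelfAdjoint hartleySqOp := by
  obtain ⟨H, hself, hmul, -⟩ := exists_isSelfAdjoint_extendsTransform_halfHartley
  rw [← hmul, ← sq]
  exact hself.pow 2

theorem hartleySqInvOp_mul_hartleySqOp : hartleySqInvOp * hartleySqOp = 1 :=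
  mul_eq_one_symm_of_isSelfAdjoint isSelfAdjoint_hartleySqOp hartleySqOp_mul_hartleySqInvOp

theorem hartleySqInvOp_hartleySqOp (f : L2HalfLine) : hartleySqInvOp (hartleySqOp f) = f :=
  DFunLike.congr_fun hartleySqInvOp_mul_hartleySqOp f

/-- The iterated half-Hartley transform as an invertible operator on `L₂(ℝ₊)`. -/
noncomputable def hartleySqEquiv : L2HalfLine ≃L[ℂ] L2HalfLine :=
  ContinuousLinearEquiv.equivOfInverse hartleySqOp hartleySqInvOp hartleySqInvOp_hartleySqOp
    (DFunLike.congr_fun hartleySqOp_mul_hartleySqInvOp)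

theorem norm_le_norm_hartleySqOp (f : L2HalfLine) : ‖f‖ ≤ ‖hartleySqOp f‖ := by
  simpa only [hartleySqInvOp_hartleySqOp, one_mul] using
    hartleySqInvOp.le_of_opNorm_le norm_hartleySqInvOp_le (hartleySqOp f)

theorem norm_hartleySqOp_apply_le (f : L2HalfLine) : ‖hartleySqOp f‖ ≤ 8 * ‖f‖ :=
  hartleySqOp.le_of_opNorm_le (norm_hartleySqOp_le.trans (by norm_num)) f

theorem ae_eq_sub_integral_logKernel_mul_hartleySqOp (f : L2HalfLine) :
    f =ᵐ[halfLine] fun x => (1 / 2 : ℂ) * hartleySqOp f x -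
      (1 / (Real.pi : ℂ) ^ 2) * ∫ t in Ioi (0 : ℝ), (logKernel x t : ℂ) * hartleySqOp f t := by
  simpa only [hartleySqInvOp_hartleySqOp] using coeFn_hartleySqInvOp (hartleySqOp f)

end Inversion

theorem theorem2 :
    -- on test functions both integrals in the iterated transform converge absolutely
    (∀ f : ℝ → ℂ, IsTestFunction f →
      IntegrableOn f (Ioi 0) ∧ IntegrableOn (halfHartley f) (Ioi 0)) ∧
    ∃ T : L2HalfLine ≃L[ℂ] L2HalfLine,
      -- `T` is the unique bounded extension of the iterated transform
      ExtendsTransform (fun f => halfHartley (halfHartley f)) (T : L2HalfLine →L[ℂ] L2HalfLine) ∧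
      (∀ T' : L2HalfLine →L[ℂ] L2HalfLine,
        ExtendsTransform (fun f => halfHartley (halfHartley f)) T' →
          T' = (T : L2HalfLine →L[ℂ] L2HalfLine)) ∧
      -- it is the square of the bounded extension of the transform itself
      (∃ H : L2HalfLine →L[ℂ] L2HalfLine, ExtendsTransform halfHartley H ∧
        (T : L2HalfLine →L[ℂ] L2HalfLine) = H.comp H) ∧
      -- the reciprocal formulas, with absolutely convergent integrals for every `x > 0`
      (∀ f : L2HalfLine,
        (∀ x : ℝ, 0 < x → IntegrableOn (fun t : ℝ => f t / ((x + t : ℝ) : ℂ)) (Ioi 0)) ∧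
        ∀ᵐ x ∂halfLine, T f x =
          2 * f x + (2 / Real.pi : ℂ) * ∫ t in Ioi (0 : ℝ), f t / ((x + t : ℝ) : ℂ)) ∧
      (∀ f : L2HalfLine,
        (∀ x : ℝ, 0 < x → IntegrableOn (fun t : ℝ => (logKernel x t : ℂ) * T f t) (Ioi 0)) ∧
        ∀ᵐ x ∂halfLine, f x =
          (1 / 2 : ℂ) * T f x -
            (1 / (Real.pi : ℂ) ^ 2) * ∫ t in Ioi (0 : ℝ), (logKernel x t : ℂ) * T f t) ∧
      -- the norm inequalities
      (∀ f : L2HalfLine, ‖f‖ ≤ ‖T f‖ ∧ ‖T f‖ ≤ 8 * ‖f‖) := by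
  obtain ⟨H, -, hmul, hH⟩ := exists_isSelfAdjoint_extendsTransform_halfHartley
  refine ⟨fun f hf => ⟨hf.integrable, hf.integrable_halfHartley⟩, hartleySqEquiv,
    extendsTransform_hartleySqOp, fun T' hT' => hT'.unique extendsTransform_hartleySqOp,
    ⟨H, hH, hmul.symm⟩, fun f => ⟨fun x hx => ?_, ?_⟩, fun f => ⟨fun x hx => ?_, ?_⟩,
    fun f => ⟨?_, ?_⟩⟩
  · exact integrable_div_add (Lp.memLp f) hx
  · exact coeFn_hartleySqOp f
  · exact integrable_logKernel_mul (Lp.memLp (hartleySqOp f)) hx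
  · exact ae_eq_sub_integral_logKernel_mul_hartleySqOp f
  · exact norm_le_norm_hartleySqOp f
  · exact norm_hartleySqOp_apply_le f
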